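/- **Setting.** Let $P,N,\sigma>0$; logarithms are to base two. Alice sends one of $M$ uniformly distributed messages by a codeword $x\in\mathbb R^n$ with $\|x\|_2\le\sqrt{nP}$. James observes $z=x+w$, $w\sim\mathcal N(0,\sigma^2 I_n)$, and, knowing the code, chooses by a (possibly randomized) map $z\mapsto s$ an attack vector with $\|s\|_2\le\sqrt{nN}$. Bob receives $y=x+s$ and decodes. The encoder and the decoder may each have private randomness of any kind and amount, and share common randomness of any kind and amount, all of it independent of the noise and hidden from James. The rate of the code is $\frac1n\log M$. A rate $R\ge0$ is achievable if there are codes, one for each $n$, of rate at least $R$ whose average error probability, in the worst case over James' strategies, tends to $0$; the capacity $C$ is the supremum of the achievable rates. The capacity under a fixed attack is defined in the same way, with James restricted to that attack. **Attack.** For $0\le\alpha\le\sqrt{N/(P+\sigma^2)}$ and $0<\epsilon<1$ put $\gamma^2=(N-\alpha^2(P+\sigma^2))(1-\epsilon)$, let $g\sim\mathcal N(0,\gamma^2I_n)$ be independent of $z$, and let $s=\beta(-\alpha z+g)$, where $\beta=1$ if $\|-\alpha z+g\|_2\le\sqrt{nN}$ and $\beta=\sqrt{nN}/\|-\alpha z+g\|_2$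 otherwise. **Theorem.** 1. The attack is admissible, that is, $\|s\|_2\le\sqrt{nN}$ always. If $\alpha<\sqrt{N/(P+\sigma^2)}$, there is $c>0$ such that for all large $n$ and all $x$ with $\|x\|_2\le\sqrt{nP}$, one has $\Pr(\beta\ne1)\le2^{-cn}$, and for every Borel set $E\subseteq\mathbb R^n$ the probabilities that $y\in E$ and that $(1-\alpha)x+\tilde g\in E$, with $\tilde g\sim\mathcal N(0,(\alpha^2\sigma^2+\gamma^2)I_n)$, differ by at most $2^{-cn}$. 2. For any private and common randomness, the capacity under this attack is at most $$\tfrac12\log\Bigl(1+\frac{(1-\alpha)^2P}{\alpha^2\sigma^2+\gamma^2}\Bigr).$$ 3. For any private and common randomness, $$C\le\min_{0<\alpha\le\sqrt{N/(P+\sigma^2)}}\tfrac12\log\Bigl(1+\frac{(1-\alpha)^2P}{N-\alpha^2P}\Bigr),$$ where the minimum is attained. 4. This minimum equals $R_{\mathrm{LD}}=\frac12\log\frac PN$ if $\frac{\sigma^2}P\le\frac1{N/P}-1$. It equals $$R_{\mathrm{myop}}=\tfrac12\log\frac{(P+\sigma^2)(P+N)-2P\sqrt{N(P+\sigma^2)}}{N\sigma^2}$$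 if $\frac{\sigma^2}P\ge\max\{\frac1{N/P}-1,\frac NP-1\}$. It equals $0$ if $\frac{\sigma^2}P\le\frac NP-1$. Hence $C\le R_{\mathrm{LD}}$, $C\le R_{\mathrm{myop}}$ and $C=0$ in the respective regions. 5. For $N>P$ the capacity with an unlimited amount of common randomness (the supremum of $C$ over all common randomness) is zero if and only if $\frac{\sigma^2}P\le\frac NP-1$. In particular it is not zero for all $N>P$, contrary to a claim in the literature. -/

import Mathlib

open MeasureTheory ProbabilityTheory Filter Topology
open scoped ENNReal

noncomputable section

namespace Myopic

/-- The space `ℝⁿ` of blocks of length `n`, with the Euclidean norm. -/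
abbrev Block (n : ℕ) : Type := EuclideanSpace ℝ (Fin n)

/-! ### Channels -/

/-- The law `𝒩(0, v Iₙ)` for `0 ≤ v`: the law of `√v • G` with `G` standard Gaussian on `ℝⁿ`. -/
def gaussianVec (n : ℕ) (v : ℝ) : Measure (Block n) :=
  (stdGaussian (Block n)).map (fun u => Real.sqrt v • u)

/-- The channel that outputs `x + s` on input `x`, where `s` is drawn from `κ x`. -/
def additive {n : ℕ} (κ : Kernel (Block n) (Block n)) : Kernel (Block n) (Block n) :=
  (Kernel.prod Kernel.id κ).map (fun p => p.1 + p.2)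

instance {n : ℕ} (v : ℝ) : IsProbabilityMeasure (gaussianVec n v) :=
  Measure.isProbabilityMeasure_map (by fun_prop)

/-- The memoryless additive white Gaussian noise channel with noise variance `v`. -/
def awgn (n : ℕ) (v : ℝ) : Kernel (Block n) (Block n) :=
  additive (Kernel.const (Block n) (gaussianVec n v))

/-- The jamming strategies of power `N`: probabilistic maps from the observation `z` to an attack
vector `s` with `‖s‖ ≤ √(nN)`. -/
def jammers (n : ℕ) (N : ℝ) : Set (Kernel (Block n) (Block n)) :=
  {J | IsMarkovKernel J ∧ ∀ z, J z (Metric.closedBall 0 (Real.sqrt (n * N)))ᶜ = 0}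

/-- The channel from Alice to Bob under the jamming strategy `J`: the jammer observes
`z = x + w` with `w ∼ 𝒩(0, σ² Iₙ)`, draws `s` from `J z`, and Bob receives `x + s`. -/
def jammed {n : ℕ} (σ : ℝ) (J : Kernel (Block n) (Block n)) : Kernel (Block n) (Block n) :=
  additive (Kernel.comp J (awgn n (σ ^ 2)))

/-! ### Codes -/

/-- A source of randomness. A string of `b` uniform bits is a special case. -/
structure RandomSource where
  Ω : Type
  [mΩ : MeasurableSpace Ω]
  law : Measure Ω
  [prob : IsProbabilityMeasure law]

attribute [instance] RandomSource.mΩ RandomSource.prob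

/-- A randomized code of block length `n` and power `P`. The encoder has private randomness `A`, the
decoder has private randomness `B`, and both know the outcome of the common randomness `K`. -/
structure Code (n : ℕ) (P : ℝ) (A B K : RandomSource) where
  M : ℕ
  M_pos : 0 < M
  enc : Fin M → A.Ω → K.Ω → Block n
  measurable_enc : ∀ m, Measurable (fun p : A.Ω × K.Ω => enc m p.1 p.2)
  power_le : ∀ m a k, ‖enc m a k‖ ≤ Real.sqrt (n * P)
  dec : Block n → B.Ω → K.Ω → Fin M
  measurable_dec : Measurable (fun p : Block n × B.Ω × K.Ω => dec p.1 p.2.1 p.2.2)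

namespace Code

variable {n : ℕ} {P : ℝ} {A B K : RandomSource}

/-- The rate, in bits per channel use. -/
def rate (C : Code n P A B K) : ℝ := Real.logb 2 C.M / n

/-- The probability of error over the channel `W`, averaged over uniformly distributed messages and
over all the randomness. -/
def errorProb (C : Code n P A B K) (W : Kernel (Block n) (Block n)) : ℝ≥0∞ :=
  (∑ m : Fin C.M, ∫⁻ k, ∫⁻ a, ∫⁻ b, W (C.enc m a k) {y | C.dec y b k ≠ m}
    ∂B.law ∂A.law ∂K.law) / C.M

end Code

/-! ### Capacity -/

/-- `R` is an achievable rate when the channel at block length `n` is chosen, with knowledge of the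
code but not of the outcomes of its randomness, from the set `𝒲 n`. -/
def Achievable (P : ℝ) (A B K : ℕ → RandomSource)
    (𝒲 : ∀ n, Set (Kernel (Block n) (Block n))) (R : ℝ) : Prop :=
  ∃ C : ∀ n, Code n P (A n) (B n) (K n), (∀ n, 1 ≤ n → R ≤ (C n).rate) ∧
    Tendsto (fun n => ⨆ W ∈ 𝒲 n, (C n).errorProb W) atTop (𝓝 0)

/-- The supremum of the achievable nonnegative rates. -/
def capacity (P : ℝ) (A B K : ℕ → RandomSource)
    (𝒲 : ∀ n, Set (Kernel (Block n) (Block n))) : EReal :=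
  sSup ((fun R : ℝ => (R : EReal)) '' {R | 0 ≤ R ∧ Achievable P A B K 𝒲 R})

/-- The capacity of the myopic adversarial channel with given private and common randomness. -/
def myopicCapacity (P N σ : ℝ) (A B K : ℕ → RandomSource) : EReal :=
  capacity P A B K (fun n => {W | ∃ J ∈ jammers n N, W = jammed σ J})

/-- The capacity of the myopic adversarial channel with an unlimited amount of common randomness. -/
def unlimitedCapacity (P N σ : ℝ) (A B : ℕ → RandomSource) : EReal :=
  ⨆ K : ℕ → RandomSource, myopicCapacity P N σ A B K

/-! ### The scale-and-babble attack -/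

/-- The factor `β` that scales an attack vector `u` back to power `N` where necessary. -/
def clip (n : ℕ) (N : ℝ) (u : Block n) : ℝ :=
  open Classical in
  if ‖u‖ ≤ Real.sqrt (n * N) then 1 else Real.sqrt (n * N) / ‖u‖

/-- The attack `s = β (-α z + g)` with `g ∼ 𝒩(0, v Iₙ)` independent of `z`. -/
def scaleBabble (n : ℕ) (N α v : ℝ) : Kernel (Block n) (Block n) :=
  (Kernel.prod Kernel.id (Kernel.const (Block n) (gaussianVec n v))).map
    (fun p => clip n N (-α • p.1 + p.2) • (-α • p.1 + p.2))

/-- The variance `γ² = (N - α² (P + σ²)) (1 - ε)` of the babble `g`. -/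
def babbleVar (P N σ α ε : ℝ) : ℝ := (N - α ^ 2 * (P + σ ^ 2)) * (1 - ε)

/-- The probability that `β ≠ 1` in the scale-and-babble attack when `x` is transmitted. -/
def clipProb (n : ℕ) (N σ α v : ℝ) (x : Block n) : ℝ :=
  ((gaussianVec n (σ ^ 2)).prod (gaussianVec n v)).real
    {p | clip n N (-α • (x + p.1) + p.2) ≠ 1}

/-! ### The rates -/

/-- The bound `½ log (1 + (1 - α)² P / (N - α² P))`. -/
def attackRate (P N α : ℝ) : ℝ :=
  1 / 2 * Real.logb 2 (1 + (1 - α) ^ 2 * P / (N - α ^ 2 * P))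

/-- `R_LD`. -/
def rateLD (P N : ℝ) : ℝ := 1 / 2 * Real.logb 2 (P / N)

/-- `R_myop`. -/
def rateMyop (P N σ : ℝ) : ℝ :=
  1 / 2 * Real.logb 2 (((P + σ ^ 2) * (P + N) - 2 * P * Real.sqrt (N * (P + σ ^ 2))) /
    (N * σ ^ 2))

end Myopic

end

/-!
Upper bounds. In the scale-and-babble attack the vector before scaling back is
`-α x + (-α w + g)`, a Gaussian vector with mean `-α x` and variance `α² σ² + γ²`. Unless it has to
be scaled back, Bob receives `(1 - α) x + (-α w + g)`, the output of a Gaussian channel. Chernoff's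
bound for the squared norm of a Gaussian vector with nonzero mean makes scaling back exponentially
unlikely if `α` is below its maximum (`scaleBabble_approx_awgn`). At the maximal `α` the power
`γ²` of the babble is zero, and scaling back can have probability about one half; in that event Bob
may well decode, so a weak converse for the Gaussian channel does not suffice. Two facts settle this
case, and all others with it (`capacity_scaleBabble_le`). The event that there is no scaling back
has probability bounded below (`gaussianVec_norm_add_sq_le_ge`). Above capacity the probability of
correct decoding over the Gaussian channel tends to zero (`awgn_strong_converse`): outside a set of
exponentially small probability, the output lies in a ball of radius about `√(n(Q + v))`, where the
output density is at most that on the noise sphere of radius about `√(nv)`, and the decoding regions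
are disjoint. Letting `ε` tend to zero gives the bound `attackRate` for the myopic channel, whose
minimum over `α` is elementary.

A positive rate for `N < P + σ²`. The codebook consists of independent Gaussian codewords of power
`a < P` and is the common randomness. Given James' observation `z`, the codeword is `x = ρ z + r`
with `ρ = a / (a + σ²)` and `r` a Gaussian vector independent of `z` (`gaussianVec_prod_eq_map`),
hence nearly orthogonal to the attack vector `s`. Therefore `⟪x, x + s⟫` is at least about
`n a - ρ ‖z‖ ‖s‖`, that is `n a (1 - √(N / (a + σ²)))`, which is a positive multiple of `n` when
`N < a + σ²` (`exists_missed_detection_le`), while any other codeword is nearly orthogonal to the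
channel output, up to an exponentially small probability (`lintegral_false_alarm_le`). A decoder
that tests correlations thus achieves a positive rate (`exists_achievable`).
-/

noncomputable section

namespace Myopic

/-! ### Gaussian vectors: characteristic function, density, exponential moments -/

/-- The Laplace transform of `exp (-b ‖u‖²)`, over the reals. -/
lemma integral_exp_neg_mul_sq_add_inner {n : ℕ} {b : ℝ} (hb : 0 < b) (w : Block n) :
    ∫ u : Block n, Real.exp (-b * ‖u‖ ^ 2 + inner ℝ w u) =
      (Real.pi / b) ^ (n / 2 : ℝ) * Real.exp (‖w‖ ^ 2 / (4 * b)) := by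
  have h := GaussianFourier.integral_cexp_neg_mul_sq_norm_add (V := Block n) (b := (b : ℂ))
    (by simpa using hb) 1 w
  rw [← Complex.ofReal_inj, ← integral_complex_ofReal]
  convert h using 1
  · congr 1
    ext u
    push_cast
    ring_nf
  · simp only [finrank_euclideanSpace, Fintype.card_fin]
    push_cast
    rw [Complex.ofReal_cpow (by positivity)]
    push_cast
    ring_nf

lemma integrable_exp_neg_mul_sq_add_inner {n : ℕ} {b : ℝ} (hb : 0 < b) (w : Block n) :
    Integrable (fun u : Block n => Real.exp (-b * ‖u‖ ^ 2 + inner ℝ w u)) := by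
  refine Integrable.of_integral_ne_zero ?_
  rw [integral_exp_neg_mul_sq_add_inner hb]
  positivity

/-- The Lebesgue density of `𝒩(0, v Iₙ)`, for `0 < v`. -/
def gaussianDensity (n : ℕ) (v : ℝ) (y : Block n) : ℝ :=
  (2 * Real.pi * v) ^ (-(n / 2 : ℝ)) * Real.exp (-(‖y‖ ^ 2 / (2 * v)))

lemma measurable_gaussianDensity (n : ℕ) (v : ℝ) : Measurable (gaussianDensity n v) := by
  unfold gaussianDensity
  fun_prop

lemma lintegral_exp_mul_gaussianDensity {n : ℕ} {v t : ℝ} (hv : 0 < v) (ht : 2 * t * v < 1)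
    (w : Block n) :
    ∫⁻ u : Block n, ENNReal.ofReal (gaussianDensity n v u) *
        ENNReal.ofReal (Real.exp (t * ‖u‖ ^ 2 + inner ℝ w u)) =
      ENNReal.ofReal ((1 - 2 * t * v) ^ (-(n / 2 : ℝ)) *
        Real.exp (v * ‖w‖ ^ 2 / (2 * (1 - 2 * t * v)))) := by
  have h1 : 0 < 1 - 2 * t * v := by linarith
  have hb : 0 < (1 - 2 * t * v) / (2 * v) := by positivity
  have hd : ∀ u : Block n, gaussianDensity n v u * Real.exp (t * ‖u‖ ^ 2 + inner ℝ w u) =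
      (2 * Real.pi * v) ^ (-(n / 2 : ℝ)) *
        Real.exp (-((1 - 2 * t * v) / (2 * v)) * ‖u‖ ^ 2 + inner ℝ w u) := fun u => by
    rw [gaussianDensity, mul_assoc, ← Real.exp_add]
    congr 2
    field_simp
    ring
  have h0 : ∀ u : Block n, 0 ≤ gaussianDensity n v u := fun u => by
    unfold gaussianDensity
    positivity
  simp_rw [← ENNReal.ofReal_mul (h0 _), hd]
  rw [← ofReal_integral_eq_lintegral_ofReal
    ((integrable_exp_neg_mul_sq_add_inner hb w).const_mul _)
    (Eventually.of_forall fun u => by positivity), integral_const_mul,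
    integral_exp_neg_mul_sq_add_inner hb]
  congr 1
  rw [← mul_assoc]
  congr 1
  · rw [Real.rpow_neg (by positivity), Real.rpow_neg h1.le, ← Real.inv_rpow (by positivity),
      ← Real.mul_rpow (by positivity) (by positivity), ← Real.inv_rpow (by positivity)]
    congr 1
    field_simp
  · congr 1
    field_simp
    ring

lemma charFun_gaussianVec {n : ℕ} {v : ℝ} (hv : 0 ≤ v) (t : Block n) :
    charFun (gaussianVec n v) t = Complex.exp (-(v * ‖t‖ ^ 2 / 2 : ℝ)) := by
  have h : ‖Real.sqrt v • t‖ ^ 2 = v * ‖t‖ ^ 2 := by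
    rw [norm_smul, Real.norm_eq_abs, mul_pow, sq_abs, Real.sq_sqrt hv]
  rw [gaussianVec, charFun_map_smul, charFun_stdGaussian, ← Complex.ofReal_pow, h]
  push_cast
  ring_nf

/-- The density is recognized by its characteristic function. -/
theorem gaussianVec_eq_withDensity (n : ℕ) {v : ℝ} (hv : 0 < v) :
    gaussianVec n v =
      volume.withDensity (fun y : Block n => ENNReal.ofReal (gaussianDensity n v y)) := by
  have hm : Measurable (fun y : Block n => ENNReal.ofReal (gaussianDensity n v y)) :=
    (measurable_gaussianDensity n v).ennreal_ofReal
  have h0 : ∀ u : Block n, 0 ≤ gaussianDensity n v u := fun u => by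
    unfold gaussianDensity
    positivity
  have hfin : IsFiniteMeasure (volume.withDensity
      (fun y : Block n => ENNReal.ofReal (gaussianDensity n v y))) := by
    refine isFiniteMeasure_withDensity ?_
    have := lintegral_exp_mul_gaussianDensity (n := n) hv (t := 0) (by simp) 0
    simp only [zero_mul, inner_zero_left, add_zero, Real.exp_zero, ENNReal.ofReal_one,
      mul_one] at this
    rw [this]
    exact ENNReal.ofReal_ne_top
  refine Measure.ext_of_charFun (funext fun t => ?_)
  rw [charFun_gaussianVec hv.le, charFun_apply,
    integral_withDensity_eq_integral_toReal_smul hm (Eventually.of_forall fun _ => by simp)]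
  have h := GaussianFourier.integral_cexp_neg_mul_sq_norm_add (V := Block n)
    (b := ((1 / (2 * v) : ℝ) : ℂ)) (by rw [Complex.ofReal_re]; positivity) Complex.I t
  have hd : ∀ u : Block n, (ENNReal.ofReal (gaussianDensity n v u)).toReal •
        Complex.exp (inner ℝ u t * Complex.I) =
      (((2 * Real.pi * v) ^ (-(n / 2 : ℝ)) : ℝ) : ℂ) *
        Complex.exp (-((1 / (2 * v) : ℝ) : ℂ) * ‖u‖ ^ 2 + Complex.I * inner ℝ t u) := fun u => by
    rw [ENNReal.toReal_ofReal (h0 u), gaussianDensity, Complex.real_smul, Complex.ofReal_mul,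
      Complex.ofReal_exp, mul_assoc, ← Complex.exp_add, real_inner_comm]
    congr 2
    push_cast
    ring
  simp_rw [hd]
  rw [integral_const_mul, h]
  simp only [finrank_euclideanSpace, Fintype.card_fin]
  have hpow : ((Real.pi : ℂ) / ((1 / (2 * v) : ℝ) : ℂ)) ^ ((n : ℂ) / 2) =
      (((2 * Real.pi * v) ^ (n / 2 : ℝ) : ℝ) : ℂ) := by
    rw [Complex.ofReal_cpow (by positivity)]
    push_cast
    congr 1
    field_simp
  rw [hpow, ← mul_assoc, ← Complex.ofReal_mul, ← Real.rpow_add (by positivity)]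
  simp only [neg_add_cancel, Real.rpow_zero, Complex.ofReal_one, one_mul, Complex.I_sq]
  congr 1
  push_cast
  field_simp
  ring

/-- The exponential moments of quadratic functions of a Gaussian vector. -/
theorem lintegral_exp_gaussianVec {n : ℕ} {v t : ℝ} (hv : 0 < v) (ht : 2 * t * v < 1)
    (w : Block n) :
    ∫⁻ u, ENNReal.ofReal (Real.exp (t * ‖u‖ ^ 2 + inner ℝ w u)) ∂gaussianVec n v =
      ENNReal.ofReal ((1 - 2 * t * v) ^ (-(n / 2 : ℝ)) *
        Real.exp (v * ‖w‖ ^ 2 / (2 * (1 - 2 * t * v)))) := by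
  rw [gaussianVec_eq_withDensity n hv, lintegral_withDensity_eq_lintegral_mul _
    (measurable_gaussianDensity n v).ennreal_ofReal (by fun_prop)]
  exact lintegral_exp_mul_gaussianDensity hv ht w

/-- A linear combination of independent Gaussian vectors is Gaussian. -/
theorem map_smul_add_smul_gaussianVec (n : ℕ) {a b : ℝ} (ha : 0 ≤ a) (hb : 0 ≤ b) (c d : ℝ) :
    ((gaussianVec n a).prod (gaussianVec n b)).map (fun p => c • p.1 + d • p.2) =
      gaussianVec n (c ^ 2 * a + d ^ 2 * b) := by
  have : IsProbabilityMeasure (((gaussianVec n a).prod (gaussianVec n b)).map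
      (fun p => c • p.1 + d • p.2)) := Measure.isProbabilityMeasure_map (by fun_prop)
  refine Measure.ext_of_charFun (funext fun t => ?_)
  rw [charFun_gaussianVec (by positivity), charFun_apply, integral_map (by fun_prop)
    (by fun_prop)]
  have h : ∀ p : Block n × Block n,
      Complex.exp (inner ℝ (c • p.1 + d • p.2) t * Complex.I) =
      Complex.exp (inner ℝ p.1 (c • t) * Complex.I) *
        Complex.exp (inner ℝ p.2 (d • t) * Complex.I) := fun p => by
    rw [← Complex.exp_add, inner_add_left, real_inner_smul_left, real_inner_smul_left,
      real_inner_smul_right, real_inner_smul_right]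
    push_cast
    ring_nf
  simp_rw [h]
  rw [integral_prod_mul (fun x : Block n => Complex.exp (inner ℝ x (c • t) * Complex.I))
    (fun x : Block n => Complex.exp (inner ℝ x (d • t) * Complex.I)), ← charFun_apply,
    ← charFun_apply, charFun_gaussianVec ha, charFun_gaussianVec hb, ← Complex.exp_add,
    norm_smul, norm_smul, mul_pow, mul_pow, Real.norm_eq_abs, Real.norm_eq_abs, sq_abs, sq_abs]
  congr 1
  push_cast
  ring

/-- Bayes' rule for a Gaussian signal in Gaussian noise: given the observation `z`, the signal is
`ρ z + r`, where `ρ z` is the estimate of least mean square error and `r` is a Gaussian vector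
independent of `z`. -/
theorem gaussianVec_prod_eq_map (n : ℕ) {a b : ℝ} (ha : 0 < a) (hb : 0 < b) :
    (gaussianVec n a).prod (gaussianVec n b) =
      ((gaussianVec n (a + b)).prod (gaussianVec n (a * b / (a + b)))).map
        (fun p => ((a / (a + b)) • p.1 + p.2, (b / (a + b)) • p.1 - p.2)) := by
  symm
  have : IsProbabilityMeasure (((gaussianVec n (a + b)).prod (gaussianVec n (a * b / (a + b)))).map
        (fun p => ((a / (a + b)) • p.1 + p.2, (b / (a + b)) • p.1 - p.2))) :=
    Measure.isProbabilityMeasure_map (by fun_prop)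
  rw [← charFun_eq_prod_iff]
  intro t
  rw [charFun_gaussianVec ha.le, charFun_gaussianVec hb.le,
    Measure.map_map (by fun_prop) (by fun_prop), charFun_apply,
    integral_map (by fun_prop) (by fun_prop)]
  set x := (WithLp.ofLp t).1
  set y := (WithLp.ofLp t).2
  have h : ∀ p : Block n × Block n,
      Complex.exp (inner ℝ ((WithLp.toLp 2 ∘ fun p : Block n × Block n =>
        ((a / (a + b)) • p.1 + p.2, (b / (a + b)) • p.1 - p.2)) p) t * Complex.I) =
      Complex.exp (inner ℝ p.1 ((a / (a + b)) • x + (b / (a + b)) • y) * Complex.I) *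
        Complex.exp (inner ℝ p.2 (x - y) * Complex.I) := fun p => by
    rw [← Complex.exp_add, WithLp.prod_inner_apply]
    simp only [Function.comp, inner_add_left, inner_sub_left, inner_add_right, inner_sub_right,
      real_inner_smul_left, real_inner_smul_right, x, y]
    push_cast
    ring_nf
  simp_rw [h]
  rw [integral_prod_mul (fun u : Block n =>
      Complex.exp (inner ℝ u ((a / (a + b)) • x + (b / (a + b)) • y) * Complex.I))
    (fun u : Block n => Complex.exp (inner ℝ u (x - y) * Complex.I)), ← charFun_apply,
    ← charFun_apply, charFun_gaussianVec (by positivity), charFun_gaussianVec (by positivity),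
    ← Complex.exp_add, ← Complex.exp_add, norm_add_sq_real, norm_sub_sq_real,
    norm_smul, norm_smul, mul_pow, mul_pow, Real.norm_eq_abs, Real.norm_eq_abs, sq_abs, sq_abs,
    real_inner_smul_left, real_inner_smul_right]
  congr 1
  norm_cast
  field_simp
  ring

/-! ### Deviations of norms and inner products of Gaussian vectors -/

/-- Chernoff's bound for a quadratic function of a Gaussian vector. -/
lemma gaussianVec_quadratic_ge_le {n : ℕ} {v t : ℝ} (hv : 0 < v) (ht : 2 * t * v < 1)
    (w : Block n) (c : ℝ) :
    gaussianVec n v {u | c ≤ t * ‖u‖ ^ 2 + inner ℝ w u} ≤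
      ENNReal.ofReal (Real.exp (v * ‖w‖ ^ 2 / (2 * (1 - 2 * t * v)) - c -
        n / 2 * Real.log (1 - 2 * t * v))) := by
  have h1 : 0 < 1 - 2 * t * v := by linarith
  have h := mul_meas_ge_le_lintegral (μ := gaussianVec n v)
    (f := fun u => ENNReal.ofReal (Real.exp (t * ‖u‖ ^ 2 + inner ℝ w u))) (by fun_prop)
    (ENNReal.ofReal (Real.exp c))
  rw [lintegral_exp_gaussianVec hv ht w] at h
  have hs : {u : Block n | ENNReal.ofReal (Real.exp c) ≤
      ENNReal.ofReal (Real.exp (t * ‖u‖ ^ 2 + inner ℝ w u))} =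
      {u | c ≤ t * ‖u‖ ^ 2 + inner ℝ w u} := by
    ext u
    simp [ENNReal.ofReal_le_ofReal_iff (Real.exp_pos _).le]
  rw [hs] at h
  have h2 : ENNReal.ofReal (Real.exp (v * ‖w‖ ^ 2 / (2 * (1 - 2 * t * v)) - c -
        n / 2 * Real.log (1 - 2 * t * v))) = ENNReal.ofReal ((1 - 2 * t * v) ^ (-(n / 2 : ℝ)) *
        Real.exp (v * ‖w‖ ^ 2 / (2 * (1 - 2 * t * v)))) / ENNReal.ofReal (Real.exp c) := by
    rw [← ENNReal.ofReal_div_of_pos (Real.exp_pos c), Real.rpow_def_of_pos h1, ← Real.exp_add,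
      ← Real.exp_sub]
    congr 2
    ring
  rw [h2, ENNReal.le_div_iff_mul_le (Or.inl (by simp [Real.exp_pos])) (Or.inl (by simp)),
    mul_comm]
  exact h

/-- The squared norm of a Gaussian vector with mean `a` exceeds its expectation by a factor with
exponentially small probability. -/
theorem exists_gaussianVec_norm_add_sq_ge_le {v A T : ℝ} (hv : 0 < v) (hA : 0 ≤ A)
    (hT : A + v < T) :
    ∃ c : ℝ, 0 < c ∧ ∀ (n : ℕ) (a : Block n), ‖a‖ ^ 2 ≤ n * A →
      gaussianVec n v {u | n * T ≤ ‖a + u‖ ^ 2} ≤ ENNReal.ofReal (Real.exp (-(c * n))) := by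
  have hT0 : 0 < T := by linarith
  -- the exponent `t` of Chernoff's bound is `(1 - q) / (2 v)`
  set q : ℝ := (1 + (A + v) / T) / 2 with hq
  have hr : (A + v) / T < 1 := (div_lt_one hT0).2 hT
  have hr0 : 0 < (A + v) / T := by positivity
  have hq1 : q < 1 := by linarith
  have hq0 : 0 < q := by linarith
  have hqT : (A + v) / q < T := by
    rw [div_lt_iff₀ hq0]
    have : (A + v) / T < q := by linarith
    rw [div_lt_iff₀ hT0] at this
    linarith
  set t : ℝ := (1 - q) / (2 * v) with htdef
  have ht0 : 0 < t := div_pos (by linarith) (by positivity)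
  have htq : 1 - 2 * t * v = q := by
    rw [htdef]
    field_simp
    ring
  refine ⟨t * (T - (A + v) / q), mul_pos ht0 (by linarith), fun n a ha => ?_⟩
  have hset : {u : Block n | n * T ≤ ‖a + u‖ ^ 2} ⊆
      {u | t * (n * T - ‖a‖ ^ 2) ≤ t * ‖u‖ ^ 2 + inner ℝ ((2 * t) • a) u} := by
    intro u hu
    simp only [Set.mem_ofPred_eq, norm_add_sq_real, real_inner_smul_left] at hu ⊢
    nlinarith
  refine (measure_mono hset).trans ((gaussianVec_quadratic_ge_le hv (by linarith) _ _).trans ?_)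
  refine ENNReal.ofReal_le_ofReal (Real.exp_le_exp.2 ?_)
  rw [htq, norm_smul, mul_pow, Real.norm_eq_abs, sq_abs]
  have hlog := Real.one_sub_inv_le_log_of_pos hq0
  have e1 : v * ((2 * t) ^ 2 * ‖a‖ ^ 2) / (2 * q) + t * ‖a‖ ^ 2 = t / q * ‖a‖ ^ 2 := by
    have : 2 * t * v = 1 - q := by linarith
    field_simp
    nlinarith
  have e2 : t / q * ‖a‖ ^ 2 ≤ t / q * (n * A) :=
    mul_le_mul_of_nonneg_left ha (by positivity)
  have e3 : (n : ℝ) / 2 * (1 - q⁻¹) ≤ n / 2 * Real.log q :=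
    mul_le_mul_of_nonneg_left hlog (by positivity)
  have e4 : (n : ℝ) / 2 * (1 - q⁻¹) = -(n * (t * v / q)) := by
    have : q = 1 - 2 * t * v := htq.symm
    field_simp
    rw [this]
    ring
  have e5 : t * (T - (A + v) / q) * n = t * (n * T) - t / q * (n * A) - n * (t * v / q) := by
    field_simp
    ring
  linarith

/-- The squared norm of a Gaussian vector falls below its expectation by a factor with
exponentially small probability. -/
theorem exists_gaussianVec_norm_sq_le_le {v θ : ℝ} (hv : 0 < v) (hθ : 0 < θ) (hθ1 : θ < 1) :
    ∃ c : ℝ, 0 < c ∧ ∀ n : ℕ,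
      gaussianVec n v {u | ‖u‖ ^ 2 ≤ n * (v * θ)} ≤ ENNReal.ofReal (Real.exp (-(c * n))) := by
  -- the exponent of Chernoff's bound is `-(q - 1) / (2 v)`
  set q : ℝ := (1 + 1 / θ) / 2 with hq
  have hθi : 1 < 1 / θ := by rw [lt_div_iff₀ hθ]; linarith
  have hq1 : 1 < q := by linarith
  have hqθ : θ < 1 / q := by
    rw [lt_div_iff₀ (by linarith)]
    have : q < 1 / θ := by linarith
    rw [lt_div_iff₀ hθ] at this
    linarith
  set s : ℝ := (q - 1) / (2 * v) with hs
  have hs0 : 0 < s := div_pos (by linarith) (by positivity)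
  have hsq : 1 - 2 * (-s) * v = q := by
    rw [hs]
    field_simp
    ring
  refine ⟨s * v * (1 / q - θ), mul_pos (by positivity) (by linarith), fun n => ?_⟩
  have hset : {u : Block n | ‖u‖ ^ 2 ≤ n * (v * θ)} ⊆
      {u | -s * (n * (v * θ)) ≤ -s * ‖u‖ ^ 2 + inner ℝ (0 : Block n) u} := by
    intro u hu
    simp only [Set.mem_ofPred_eq, inner_zero_left] at hu ⊢
    nlinarith
  refine (measure_mono hset).trans ((gaussianVec_quadratic_ge_le hv (by linarith) _ _).trans ?_)
  refine ENNReal.ofReal_le_ofReal (Real.exp_le_exp.2 ?_)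
  have hq0 : 0 < q := by linarith
  have hlog := Real.one_sub_inv_le_log_of_pos hq0
  have e3 : (n : ℝ) / 2 * (1 - q⁻¹) ≤ n / 2 * Real.log q :=
    mul_le_mul_of_nonneg_left hlog (by positivity)
  have e4 : (n : ℝ) / 2 * (1 - q⁻¹) = n * (s * v / q) := by
    have h2 : 2 * s * v = q - 1 := by linarith
    field_simp
    rw [← h2]
    ring
  rw [hsq, norm_zero]
  have e5 : s * v * (1 / q - θ) * n = n * (s * v / q) - s * (n * (v * θ)) := by
    field_simp
  have e6 : v * (0 : ℝ) ^ 2 / (2 * q) = 0 := by simp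
  linarith

/-- The Gaussian tail of an inner product. -/
theorem gaussianVec_inner_ge_le {n : ℕ} {v B θ : ℝ} (hv : 0 < v) (hB : 0 < B) (hθ : 0 < θ)
    {w : Block n} (hw : ‖w‖ ^ 2 ≤ n * B) :
    gaussianVec n v {u | n * θ ≤ inner ℝ w u} ≤
      ENNReal.ofReal (Real.exp (-(θ ^ 2 / (2 * v * B) * n))) := by
  set l : ℝ := θ / (v * B) with hl
  have hl0 : 0 < l := by positivity
  have hset : {u : Block n | n * θ ≤ inner ℝ w u} ⊆
      {u | l * (n * θ) ≤ 0 * ‖u‖ ^ 2 + inner ℝ (l • w) u} := by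
    intro u hu
    simp only [Set.mem_ofPred_eq, real_inner_smul_left] at hu ⊢
    nlinarith
  refine (measure_mono hset).trans ((gaussianVec_quadratic_ge_le hv (by simp) _ _).trans ?_)
  refine ENNReal.ofReal_le_ofReal (Real.exp_le_exp.2 ?_)
  rw [norm_smul, mul_pow, Real.norm_eq_abs, sq_abs]
  simp only [mul_zero, zero_mul, sub_zero, Real.log_one, mul_one]
  have e1 : v * (l ^ 2 * ‖w‖ ^ 2) / 2 ≤ v * (l ^ 2 * (n * B)) / 2 := by gcongr
  have e2 : v * (l ^ 2 * (n * B)) / 2 - l * (n * θ) = -(θ ^ 2 / (2 * v * B) * n) := by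
    rw [hl]
    field_simp
    ring
  linarith

/-- The Laplace transform of the normalized squared norm of a Gaussian vector is near that of a
Gaussian variable of variance `2`. -/
lemma exists_lintegral_exp_norm_sq {n : ℕ} {v k : ℝ} (hv : 0 < v) (hk : 0 < k) (hn : 0 < n)
    (hkn : 4 * k ≤ Real.sqrt n) :
    ∃ r : ℝ, |r| ≤ 8 * k ^ 3 / Real.sqrt n ∧
      ∫⁻ u, ENNReal.ofReal (Real.exp (k * Real.sqrt n - k / (Real.sqrt n * v) * ‖u‖ ^ 2))
        ∂gaussianVec n v = ENNReal.ofReal (Real.exp (k ^ 2 + r)) := by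
  set m : ℝ := Real.sqrt n with hm
  have hn' : (0 : ℝ) < n := by exact_mod_cast hn
  have hm0 : 0 < m := Real.sqrt_pos.2 hn'
  have hmn : (n : ℝ) = m ^ 2 := (Real.sq_sqrt hn'.le).symm
  set y : ℝ := 2 * k / m with hy
  have hy0 : 0 < y := by positivity
  have hy1 : y ≤ 1 / 2 := by
    rw [hy, div_le_iff₀ hm0]
    linarith
  have ht : 1 - 2 * (-(k / (m * v))) * v = 1 + y := by
    rw [hy]
    field_simp
    ring
  have hlog := Real.abs_log_sub_add_sum_range_le (x := -y)
    (by rw [abs_neg, abs_of_pos hy0]; linarith) 2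
  simp only [Finset.sum_range_succ, Finset.sum_range_zero, abs_neg, abs_of_pos hy0] at hlog
  norm_num at hlog
  have hfrac : y ^ 3 / (1 - y) ≤ 2 * y ^ 3 := by
    rw [div_le_iff₀ (by linarith)]
    nlinarith [pow_pos hy0 3]
  refine ⟨k * m - n / 2 * Real.log (1 + y) - k ^ 2, ?_, ?_⟩
  · have e : k * m - n / 2 * Real.log (1 + y) - k ^ 2 =
        -(n / 2 * (-y + y ^ 2 / 2 + Real.log (1 + y))) := by
      rw [hmn, hy]
      field_simp
      ring
    rw [e, abs_neg, abs_mul, abs_of_pos (by positivity)]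
    calc (n : ℝ) / 2 * |-y + y ^ 2 / 2 + Real.log (1 + y)| ≤ n / 2 * (2 * y ^ 3) :=
          mul_le_mul_of_nonneg_left (hlog.trans hfrac) (by positivity)
      _ = 8 * k ^ 3 / m := by
          rw [hmn, hy]
          field_simp
          ring
  · have h := lintegral_exp_gaussianVec (n := n) (t := -(k / (m * v))) hv
      (by linarith) 0
    have hs : ∀ u : Block n, ENNReal.ofReal (Real.exp (k * m - k / (m * v) * ‖u‖ ^ 2)) =
        ENNReal.ofReal (Real.exp (k * m)) * ENNReal.ofReal
          (Real.exp (-(k / (m * v)) * ‖u‖ ^ 2 + inner ℝ (0 : Block n) u)) := fun u => by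
      rw [← ENNReal.ofReal_mul (Real.exp_pos _).le, ← Real.exp_add, inner_zero_left]
      ring_nf
    simp_rw [hs]
    rw [lintegral_const_mul _ (by fun_prop), h, ← ENNReal.ofReal_mul (Real.exp_pos _).le, ht,
      Real.rpow_def_of_pos (by linarith), ← Real.exp_add, ← Real.exp_add, norm_zero]
    congr 2
    simp
    ring

/-- The squared norm of a Gaussian vector is at most its expectation with probability bounded
below. If `X` denotes its normalized deviation, then `e^(-X/4) ≤ e^(-X/8)` where `0 < X`, so that
the excess of `E e^(-X/4)` over `E e^(-X/8)` comes from the event `X ≤ 0`. -/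
theorem gaussianVec_norm_sq_le_ge {n : ℕ} {v : ℝ} (hv : 0 < v) (hn : 10000 ≤ n) :
    ENNReal.ofReal (1 / 5000) ≤ gaussianVec n v {u | ‖u‖ ^ 2 ≤ n * v} := by
  set m : ℝ := Real.sqrt n with hm
  have hn0 : 0 < n := by omega
  have hn' : (0 : ℝ) < n := by exact_mod_cast hn0
  have hm100 : 100 ≤ m := by
    rw [hm]
    refine Real.le_sqrt_of_sq_le ?_
    have : (10000 : ℝ) ≤ n := by exact_mod_cast hn
    linarith
  have hm0 : 0 < m := by linarith
  have hmn : (n : ℝ) = m ^ 2 := (Real.sq_sqrt hn'.le).symm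
  set f : ℝ → Block n → ℝ := fun k u => Real.exp (k * m - k / (m * v) * ‖u‖ ^ 2) with hf
  obtain ⟨r1, hr1, h1⟩ := exists_lintegral_exp_norm_sq (n := n) (k := 1 / 8) hv (by norm_num) hn0
    (by linarith)
  obtain ⟨r2, hr2, h2⟩ := exists_lintegral_exp_norm_sq (n := n) (k := 1 / 4) hv (by norm_num) hn0
    (by linarith)
  obtain ⟨r3, hr3, h3⟩ := exists_lintegral_exp_norm_sq (n := n) (k := 1 / 2) hv (by norm_num) hn0
    (by linarith)
  have hS : MeasurableSet {u : Block n | ‖u‖ ^ 2 ≤ n * v} :=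
    measurableSet_le (by fun_prop) (by fun_prop)
  -- the last two terms dominate `e^(-X/4)` where `X ≤ 0`, as `y ≤ y ^ 2 / 100 + 25`
  have hpt : ∀ u : Block n, ENNReal.ofReal (f (1 / 4) u) ≤
      ENNReal.ofReal (f (1 / 8) u) + ENNReal.ofReal (1 / 100) * ENNReal.ofReal (f (1 / 2) u) +
        ENNReal.ofReal 25 * {u : Block n | ‖u‖ ^ 2 ≤ n * v}.indicator 1 u := by
    intro u
    by_cases hu : ‖u‖ ^ 2 ≤ n * v
    · have hsq : f (1 / 2) u = f (1 / 4) u ^ 2 := by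
        simp only [hf]
        rw [← Real.exp_nat_mul]
        congr 1
        push_cast
        ring
      rw [Set.indicator_of_mem (by exact hu), Pi.one_apply, mul_one,
        ← ENNReal.ofReal_mul (by norm_num), ← ENNReal.ofReal_add (by positivity) (by positivity),
        ← ENNReal.ofReal_add (by positivity) (by positivity), hsq]
      refine ENNReal.ofReal_le_ofReal ?_
      have : 0 < f (1 / 8) u := Real.exp_pos _
      nlinarith [sq_nonneg (f (1 / 4) u - 50)]
    · rw [add_assoc]
      refine le_add_right (ENNReal.ofReal_le_ofReal (Real.exp_le_exp.2 ?_))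
      have hu' : m * m * v ≤ ‖u‖ ^ 2 := by
        rw [hmn] at hu
        nlinarith
      have : m ≤ 1 / (m * v) * ‖u‖ ^ 2 := by
        rw [one_div, inv_mul_eq_div, le_div_iff₀ (by positivity)]
        linarith
      have e4 : (1 / 4 : ℝ) / (m * v) * ‖u‖ ^ 2 = 1 / 4 * (1 / (m * v) * ‖u‖ ^ 2) := by ring
      have e8 : (1 / 8 : ℝ) / (m * v) * ‖u‖ ^ 2 = 1 / 8 * (1 / (m * v) * ‖u‖ ^ 2) := by ring
      rw [e4, e8]
      linarith
  have hint := lintegral_mono (μ := gaussianVec n v) hpt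
  have hfm : ∀ k : ℝ, Measurable (fun u => ENNReal.ofReal (f k u)) := fun k => by
    simp only [hf]
    fun_prop
  rw [lintegral_add_right _ ((measurable_one.indicator hS).const_mul _),
    lintegral_add_left (hfm _), lintegral_const_mul _ (hfm _),
    lintegral_const_mul _ (measurable_one.indicator hS), lintegral_indicator_one hS,
    h1, h2, h3] at hint
  set p := gaussianVec n v {u | ‖u‖ ^ 2 ≤ n * v} with hp
  have hpt : p ≠ ∞ := measure_ne_top _ _
  have hpr : p = ENNReal.ofReal p.toReal := (ENNReal.ofReal_toReal hpt).symm
  rw [hpr] at hint ⊢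
  rw [← ENNReal.ofReal_mul (by norm_num), ← ENNReal.ofReal_mul (by norm_num),
    ← ENNReal.ofReal_add (by positivity) (by positivity),
    ← ENNReal.ofReal_add (by positivity) (by positivity),
    ENNReal.ofReal_le_ofReal_iff (by positivity)] at hint
  refine ENNReal.ofReal_le_ofReal ?_
  have b1 : |r1| ≤ 1 / 6400 := hr1.trans (by
    rw [div_le_iff₀ hm0]; norm_num; linarith)
  have b2 : |r2| ≤ 1 / 800 := hr2.trans (by
    rw [div_le_iff₀ hm0]; norm_num; linarith)
  have b3 : |r3| ≤ 1 / 100 := hr3.trans (by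
    rw [div_le_iff₀ hm0]; norm_num; linarith)
  have c1 : Real.exp ((1 / 8) ^ 2 + r1) ≤ 1.02 := by
    have h : (1 / 8 : ℝ) ^ 2 + r1 ≤ 1 - 1.02⁻¹ := by
      have := (abs_le.1 b1).2
      norm_num
      linarith
    calc Real.exp ((1 / 8) ^ 2 + r1) ≤ Real.exp (1 - 1.02⁻¹) := Real.exp_le_exp.2 h
      _ ≤ Real.exp (Real.log 1.02) :=
          Real.exp_le_exp.2 (Real.one_sub_inv_le_log_of_pos (by norm_num))
      _ = 1.02 := Real.exp_log (by norm_num)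
  have c2 : 1.06 ≤ Real.exp ((1 / 4) ^ 2 + r2) := by
    have := (abs_le.1 b2).1
    have := Real.add_one_le_exp ((1 / 4) ^ 2 + r2)
    norm_num at *
    linarith
  have c3 : Real.exp ((1 / 2) ^ 2 + r3) ≤ 2.72 := by
    have := (abs_le.1 b3).2
    have h : (1 / 2 : ℝ) ^ 2 + r3 ≤ 1 := by norm_num; linarith
    exact (Real.exp_le_exp.2 h).trans (by have := Real.exp_one_lt_d9; linarith)
  norm_num at hint c1 c2 c3 ⊢
  linarith

lemma map_neg_gaussianVec (n : ℕ) {v : ℝ} (hv : 0 ≤ v) :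
    (gaussianVec n v).map (fun u => -u) = gaussianVec n v := by
  have : IsProbabilityMeasure ((gaussianVec n v).map (fun u => -u)) :=
    Measure.isProbabilityMeasure_map (by fun_prop)
  refine Measure.ext_of_charFun (funext fun t => ?_)
  have : (fun u : Block n => -u) = fun u => (-1 : ℝ) • u := by ext; simp
  rw [this, charFun_map_smul, charFun_gaussianVec hv, charFun_gaussianVec hv]
  simp

/-- The squared norm of a Gaussian vector with mean `a` is at most its expectation with probability
bounded below: of `u` and `-u`, at least one makes an obtuse angle with `a`. -/
theorem gaussianVec_norm_add_sq_le_ge {n : ℕ} {v A T : ℝ} (hv : 0 < v) (hn : 10000 ≤ n)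
    (hT : A + v ≤ T) {a : Block n} (ha : ‖a‖ ^ 2 ≤ n * A) :
    ENNReal.ofReal (1 / 10000) ≤ gaussianVec n v {u | ‖a + u‖ ^ 2 ≤ n * T} := by
  set S : Set (Block n) := {u | ‖a + u‖ ^ 2 ≤ n * T} with hS
  have hSm : MeasurableSet S := measurableSet_le (by fun_prop) (by fun_prop)
  have hsub : {u : Block n | ‖u‖ ^ 2 ≤ n * v} ⊆ S ∪ (fun u => -u) ⁻¹' S := by
    intro u hu
    simp only [hS, Set.mem_ofPred_eq, Set.mem_union, Set.mem_preimage] at hu ⊢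
    have hTn : (n : ℝ) * (A + v) ≤ n * T := mul_le_mul_of_nonneg_left hT (by positivity)
    rcases le_total (inner ℝ a u) 0 with h | h
    · left
      rw [norm_add_sq_real]
      linarith
    · right
      rw [norm_add_sq_real, inner_neg_right, norm_neg]
      linarith
  have h2 : gaussianVec n v ((fun u => -u) ⁻¹' S) = gaussianVec n v S := by
    conv_rhs => rw [← map_neg_gaussianVec n hv.le]
    rw [Measure.map_apply (by fun_prop) hSm]
  have h := (gaussianVec_norm_sq_le_ge hv hn).trans
    ((measure_mono hsub).trans (measure_union_le _ _))
  rw [h2, ← two_mul] at h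
  have e : ENNReal.ofReal (1 / 5000) = 2 * ENNReal.ofReal (1 / 10000) := by
    rw [show (2 : ℝ≥0∞) = ENNReal.ofReal 2 by simp, ← ENNReal.ofReal_mul (by norm_num)]
    norm_num
  rw [e] at h
  exact (ENNReal.mul_le_mul_iff_right (by simp) (by simp)).1 h

/-! ### The channels, evaluated -/

lemma additive_apply {n : ℕ} (κ : Kernel (Block n) (Block n)) [IsSFiniteKernel κ] (x : Block n) :
    additive κ x = (κ x).map (fun s => x + s) := by
  rw [additive, Kernel.map_apply _ (by fun_prop), Kernel.prod_apply, Kernel.id_apply,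
    Measure.dirac_prod, Measure.map_map (by fun_prop) (by fun_prop)]
  rfl

lemma awgn_apply {n : ℕ} (v : ℝ) (x : Block n) :
    awgn n v x = (gaussianVec n v).map (fun u => x + u) := by
  rw [awgn, additive_apply, Kernel.const_apply]

instance {n : ℕ} (κ : Kernel (Block n) (Block n)) [IsMarkovKernel κ] :
    IsMarkovKernel (additive κ) :=
  Kernel.IsMarkovKernel.map _ (by fun_prop)

instance {n : ℕ} (v : ℝ) : IsMarkovKernel (awgn n v) := by
  unfold awgn
  infer_instance

instance {n : ℕ} (σ : ℝ) (J : Kernel (Block n) (Block n)) [IsMarkovKernel J] :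
    IsMarkovKernel (jammed σ J) := by
  unfold jammed
  infer_instance

lemma lintegral_awgn {n : ℕ} (v : ℝ) (x : Block n) {f : Block n → ℝ≥0∞} (hf : Measurable f) :
    ∫⁻ z, f z ∂awgn n v x = ∫⁻ u, f (x + u) ∂gaussianVec n v := by
  rw [awgn_apply, lintegral_map hf (by fun_prop)]

lemma jammed_apply {n : ℕ} (σ : ℝ) (J : Kernel (Block n) (Block n)) [IsMarkovKernel J]
    (x : Block n) {E : Set (Block n)} (hE : MeasurableSet E) :
    jammed σ J x E =
      ∫⁻ w, J (x + w) ((fun s => x + s) ⁻¹' E) ∂gaussianVec n (σ ^ 2) := by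
  have hE' : MeasurableSet ((fun s => x + s) ⁻¹' E) := (measurable_const_add x) hE
  rw [jammed, additive_apply, Measure.map_apply (by fun_prop) hE, Kernel.comp_apply' _ _ _ hE',
    lintegral_awgn _ _ (Kernel.measurable_coe J hE')]

/-! ### The scale-and-babble attack -/

lemma measurable_clip (n : ℕ) (N : ℝ) : Measurable (clip n N) := by
  unfold clip
  exact Measurable.ite (measurableSet_le (by fun_prop) (by fun_prop)) (by fun_prop) (by fun_prop)

lemma norm_clip_smul_le {n : ℕ} (N : ℝ) (u : Block n) :
    ‖clip n N u • u‖ ≤ Real.sqrt (n * N) := by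
  unfold clip
  split_ifs with h
  · simpa using h
  · have hu : 0 < ‖u‖ := (Real.sqrt_nonneg _).trans_lt (not_le.1 h)
    rw [norm_smul, norm_div, norm_norm, Real.norm_of_nonneg (Real.sqrt_nonneg _),
      div_mul_cancel₀ _ hu.ne']

lemma lt_norm_sq_of_clip_ne_one {n : ℕ} {N : ℝ} {u : Block n}
    (h : clip n N u ≠ 1) : n * N < ‖u‖ ^ 2 := by
  have h1 : Real.sqrt (n * N) < ‖u‖ := by
    by_contra h'
    exact h (if_pos (not_lt.1 h'))
  rwa [Real.sqrt_lt' ((Real.sqrt_nonneg _).trans_lt h1)] at h1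

lemma scaleBabble_apply {n : ℕ} (N α v : ℝ) (z : Block n) :
    scaleBabble n N α v z = (gaussianVec n v).map
      (fun g => clip n N (-α • z + g) • (-α • z + g)) := by
  have hm := measurable_clip n N
  rw [scaleBabble, Kernel.map_apply _ (by fun_prop), Kernel.prod_apply, Kernel.id_apply,
    Kernel.const_apply, Measure.dirac_prod, Measure.map_map (by fun_prop) (by fun_prop)]
  rfl

instance {n : ℕ} (N α v : ℝ) : IsMarkovKernel (scaleBabble n N α v) := by
  have hm := measurable_clip n N
  unfold scaleBabble
  exact Kernel.IsMarkovKernel.map _ (by fun_prop)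

theorem scaleBabble_mem_jammers (n : ℕ) (N α v : ℝ) : scaleBabble n N α v ∈ jammers n N := by
  have hm := measurable_clip n N
  rw [jammers, Set.mem_ofPred_eq]
  refine ⟨inferInstance, fun z => ?_⟩
  rw [scaleBabble_apply, Measure.map_apply (by fun_prop)
    Metric.isClosed_closedBall.measurableSet.compl]
  refine measure_mono_null (fun g hg => ?_) measure_empty
  exact hg (mem_closedBall_zero_iff.2 (norm_clip_smul_le N _))

/-- The unscaled attack vector `-α (x + w) + g`, as a function of `(w, g)`. -/
def babble {n : ℕ} (α : ℝ) (x : Block n) (p : Block n × Block n) : Block n :=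
  -α • (x + p.1) + p.2

lemma measurable_babble {n : ℕ} (α : ℝ) (x : Block n) : Measurable (babble α x) := by
  unfold babble
  fun_prop

lemma map_babble {n : ℕ} {σ v : ℝ} (hv : 0 ≤ v) (α : ℝ) (x : Block n) :
    ((gaussianVec n (σ ^ 2)).prod (gaussianVec n v)).map (babble α x) =
      (gaussianVec n (α ^ 2 * σ ^ 2 + v)).map (fun u => -α • x + u) := by
  have h := map_smul_add_smul_gaussianVec n (sq_nonneg σ) hv (-α) 1
  rw [show (-α) ^ 2 * σ ^ 2 + 1 ^ 2 * v = α ^ 2 * σ ^ 2 + v by ring] at h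
  rw [← h, Measure.map_map (by fun_prop) (by fun_prop)]
  congr 1
  ext1 p
  simp only [babble, Function.comp_apply, smul_add, one_smul]
  abel

lemma jammed_scaleBabble_apply {n : ℕ} (N σ α v : ℝ) (x : Block n) {E : Set (Block n)}
    (hE : MeasurableSet E) :
    jammed σ (scaleBabble n N α v) x E = ((gaussianVec n (σ ^ 2)).prod (gaussianVec n v))
      {p | x + clip n N (babble α x p) • babble α x p ∈ E} := by
  have hm := measurable_clip n N
  have hb := measurable_babble α x
  rw [jammed_apply _ _ _ hE, Measure.prod_apply]
  · refine lintegral_congr fun w => ?_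
    rw [scaleBabble_apply, Measure.map_apply (by fun_prop) ((measurable_const_add x) hE)]
    rfl
  · exact (show Measurable fun p => x + clip n N (babble α x p) • babble α x p by fun_prop) hE

lemma awgn_eq_babble {n : ℕ} {σ v : ℝ} (hv : 0 ≤ v) (α : ℝ) (x : Block n) {E : Set (Block n)}
    (hE : MeasurableSet E) :
    awgn n (α ^ 2 * σ ^ 2 + v) ((1 - α) • x) E =
      ((gaussianVec n (σ ^ 2)).prod (gaussianVec n v)) {p | x + babble α x p ∈ E} := by
  have hb := measurable_babble α x
  have h : awgn n (α ^ 2 * σ ^ 2 + v) ((1 - α) • x) =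
      (((gaussianVec n (σ ^ 2)).prod (gaussianVec n v)).map (babble α x)).map
        (fun u => x + u) := by
    rw [map_babble hv, awgn_apply, Measure.map_map (by fun_prop) (by fun_prop)]
    congr 1
    ext1 u
    simp only [Function.comp_apply, sub_smul, one_smul, neg_smul]
    abel
  rw [h, Measure.map_map (by fun_prop) hb, Measure.map_apply (by fun_prop) hE]
  rfl

/-- The event that the attack vector has to be scaled back. -/
def clipEvent {n : ℕ} (N α : ℝ) (x : Block n) : Set (Block n × Block n) :=
  {p | clip n N (babble α x p) ≠ 1}

lemma jammed_le_awgn_add {n : ℕ} {σ v : ℝ} (hv : 0 ≤ v) (N α : ℝ) (x : Block n)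
    {E : Set (Block n)} (hE : MeasurableSet E) :
    jammed σ (scaleBabble n N α v) x E ≤ awgn n (α ^ 2 * σ ^ 2 + v) ((1 - α) • x) E +
      ((gaussianVec n (σ ^ 2)).prod (gaussianVec n v)) (clipEvent N α x) := by
  rw [jammed_scaleBabble_apply N σ α v x hE, awgn_eq_babble hv α x hE]
  refine (measure_mono fun p hp => ?_).trans (measure_union_le _ _)
  by_cases h : clip n N (babble α x p) = 1
  · left
    simpa [h] using hp
  · exact Or.inr h

lemma awgn_le_jammed_add {n : ℕ} {σ v : ℝ} (hv : 0 ≤ v) (N α : ℝ) (x : Block n)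
    {E : Set (Block n)} (hE : MeasurableSet E) :
    awgn n (α ^ 2 * σ ^ 2 + v) ((1 - α) • x) E ≤ jammed σ (scaleBabble n N α v) x E +
      ((gaussianVec n (σ ^ 2)).prod (gaussianVec n v)) (clipEvent N α x) := by
  rw [jammed_scaleBabble_apply N σ α v x hE, awgn_eq_babble hv α x hE]
  refine (measure_mono fun p hp => ?_).trans (measure_union_le _ _)
  by_cases h : clip n N (babble α x p) = 1
  · left
    simpa [h] using hp
  · exact Or.inr h

lemma measure_clipEvent_le {n : ℕ} {σ v : ℝ} (hv : 0 ≤ v) (N α : ℝ) (x : Block n) :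
    ((gaussianVec n (σ ^ 2)).prod (gaussianVec n v)) (clipEvent N α x) ≤
      gaussianVec n (α ^ 2 * σ ^ 2 + v) {u | n * N < ‖-α • x + u‖ ^ 2} := by
  have hS : MeasurableSet {u : Block n | n * N < ‖u‖ ^ 2} :=
    measurableSet_lt (by fun_prop) (by fun_prop)
  have h := congrArg (fun μ => μ {u : Block n | n * N < ‖u‖ ^ 2}) (map_babble (σ := σ) hv α x)
  rw [Measure.map_apply (measurable_babble α x) hS, Measure.map_apply (by fun_prop) hS] at h
  refine le_trans (measure_mono fun p hp => ?_) h.le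
  exact lt_norm_sq_of_clip_ne_one hp

lemma norm_smul_sq_le {n : ℕ} {P : ℝ} (hP : 0 ≤ P) (a : ℝ) {x : Block n}
    (hx : ‖x‖ ≤ Real.sqrt (n * P)) : ‖a • x‖ ^ 2 ≤ n * (a ^ 2 * P) := by
  have h : ‖x‖ ^ 2 ≤ n * P := by
    rw [← Real.sq_sqrt (show (0 : ℝ) ≤ n * P by positivity)]
    gcongr
  rw [norm_smul, mul_pow, Real.norm_eq_abs, sq_abs]
  nlinarith [mul_le_mul_of_nonneg_left h (sq_nonneg a)]

/-- Below full power, the attack vector is scaled back with exponentially small probability. -/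
theorem exists_measure_clipEvent_le {P N σ α v : ℝ} (hP : 0 ≤ P) (hv : 0 < v)
    (h : α ^ 2 * (P + σ ^ 2) + v < N) :
    ∃ c : ℝ, 0 < c ∧ ∀ (n : ℕ) (x : Block n), ‖x‖ ≤ Real.sqrt (n * P) →
      ((gaussianVec n (σ ^ 2)).prod (gaussianVec n v)) (clipEvent N α x) ≤
        ENNReal.ofReal (Real.exp (-(c * n))) := by
  obtain ⟨c, hc, hb⟩ := exists_gaussianVec_norm_add_sq_ge_le (v := α ^ 2 * σ ^ 2 + v)
    (A := α ^ 2 * P) (T := N) (by positivity) (by positivity) (by linarith)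
  refine ⟨c, hc, fun n x hx => (measure_clipEvent_le hv.le N α x).trans
    (le_trans (measure_mono fun u hu => ?_) (hb n (-α • x)
      (neg_sq α ▸ norm_smul_sq_le hP (-α) hx)))⟩
  exact le_of_lt (show n * N < _ from hu)

/-- Up to full power included, the probability that the attack vector is scaled back stays away
from one. -/
theorem measure_clipEvent_le_sub {n : ℕ} {P N σ α v : ℝ} (hP : 0 ≤ P) (hv : 0 ≤ v)
    (hvα : 0 < α ^ 2 * σ ^ 2 + v) (hn : 10000 ≤ n) (h : α ^ 2 * (P + σ ^ 2) + v ≤ N)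
    {x : Block n} (hx : ‖x‖ ≤ Real.sqrt (n * P)) :
    ((gaussianVec n (σ ^ 2)).prod (gaussianVec n v)) (clipEvent N α x) ≤
      1 - ENNReal.ofReal (1 / 10000) := by
  have hS : MeasurableSet {u : Block n | ‖-α • x + u‖ ^ 2 ≤ n * N} :=
    measurableSet_le (by fun_prop) (by fun_prop)
  have hb := gaussianVec_norm_add_sq_le_ge hvα hn (T := N) (by linarith)
    (neg_sq α ▸ norm_smul_sq_le hP (-α) hx)
  refine (measure_clipEvent_le hv N α x).trans ?_
  have : {u : Block n | n * N < ‖-α • x + u‖ ^ 2} = {u | ‖-α • x + u‖ ^ 2 ≤ n * N}ᶜ := by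
    ext u
    simp
  rw [this, prob_compl_eq_one_sub hS]
  exact tsub_le_tsub_left hb _

lemma babbleVar_nonneg {P N σ α ε : ℝ} (h : α ^ 2 * (P + σ ^ 2) ≤ N) (hε : ε < 1) :
    0 ≤ babbleVar P N σ α ε :=
  mul_nonneg (by linarith) (by linarith)

lemma sq_mul_le_of_le_sqrt {P N σ α : ℝ} (hP : 0 < P) (hN : 0 < N) (hα : 0 ≤ α)
    (h : α ≤ Real.sqrt (N / (P + σ ^ 2))) : α ^ 2 * (P + σ ^ 2) ≤ N := by
  have hS : 0 < P + σ ^ 2 := by positivity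
  rwa [Real.le_sqrt hα (by positivity), le_div_iff₀ hS] at h

lemma sq_mul_lt_of_lt_sqrt {P N σ α : ℝ} (hP : 0 < P) (hα : 0 ≤ α)
    (h : α < Real.sqrt (N / (P + σ ^ 2))) : α ^ 2 * (P + σ ^ 2) < N := by
  have hS : 0 < P + σ ^ 2 := by positivity
  rwa [Real.lt_sqrt hα, lt_div_iff₀ hS] at h

/-- Below full power, the scale-and-babble attack turns the channel into a memoryless Gaussian
channel, up to an exponentially small error. -/
theorem scaleBabble_approx_awgn {P N σ α ε : ℝ} (hP : 0 < P) (hα : 0 ≤ α)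
    (hα1 : α < Real.sqrt (N / (P + σ ^ 2))) (hε : 0 < ε) (hε1 : ε < 1) :
    ∃ c : ℝ, 0 < c ∧ ∀ (n : ℕ) (x : Block n), ‖x‖ ≤ Real.sqrt (n * P) →
      clipProb n N σ α (babbleVar P N σ α ε) x ≤ (2 : ℝ) ^ (-(c * n)) ∧
      ∀ E : Set (Block n), MeasurableSet E →
        |(jammed σ (scaleBabble n N α (babbleVar P N σ α ε)) x).real E -
          (awgn n (α ^ 2 * σ ^ 2 + babbleVar P N σ α ε) ((1 - α) • x)).real E| ≤
            (2 : ℝ) ^ (-(c * n)) := by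
  have hlt := sq_mul_lt_of_lt_sqrt hP hα hα1
  have hv : 0 < babbleVar P N σ α ε := mul_pos (by linarith) (by linarith)
  have hsum : α ^ 2 * (P + σ ^ 2) + babbleVar P N σ α ε < N := by
    unfold babbleVar
    nlinarith
  obtain ⟨c, hc, hb⟩ := exists_measure_clipEvent_le hP.le hv hsum
  have h2 : 0 < Real.log 2 := Real.log_pos (by norm_num)
  refine ⟨c / Real.log 2, by positivity, fun n x hx => ?_⟩
  have he : (2 : ℝ) ^ (-(c / Real.log 2 * n)) = Real.exp (-(c * n)) := by
    rw [Real.rpow_def_of_pos (by norm_num)]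
    congr 1
    field_simp
  have hbx := hb n x hx
  have hbx' : ((gaussianVec n (σ ^ 2)).prod (gaussianVec n (babbleVar P N σ α ε))).real
      (clipEvent N α x) ≤ Real.exp (-(c * n)) := by
    rw [measureReal_def]
    exact ENNReal.toReal_le_of_le_ofReal (Real.exp_pos _).le hbx
  rw [he]
  refine ⟨hbx', fun E hE => ?_⟩
  have g1 := ENNReal.toReal_mono (by finiteness) (jammed_le_awgn_add (σ := σ) hv.le N α x hE)
  have g2 := ENNReal.toReal_mono (by finiteness) (awgn_le_jammed_add (σ := σ) hv.le N α x hE)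
  rw [ENNReal.toReal_add (by finiteness) (by finiteness)] at g1 g2
  simp only [measureReal_def] at hbx' ⊢
  rw [abs_le]
  constructor <;> linarith

/-! ### The strong converse for the Gaussian channel -/

/-- A ball of radius `√(nT)` has Gaussian measure at most one, which bounds its volume. -/
lemma volume_norm_sq_le_le (n : ℕ) {T : ℝ} (hT : 0 < T) :
    volume {y : Block n | ‖y‖ ^ 2 ≤ n * T} ≤
      ENNReal.ofReal ((2 * Real.pi * T) ^ (n / 2 : ℝ) * Real.exp (n / 2)) := by
  set B : Set (Block n) := {y | ‖y‖ ^ 2 ≤ n * T} with hB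
  have hBm : MeasurableSet B := measurableSet_le (by fun_prop) (by fun_prop)
  set κ : ℝ := (2 * Real.pi * T) ^ (n / 2 : ℝ) * Real.exp (n / 2) with hκ
  have hκ0 : 0 < κ := by positivity
  have h1 : ENNReal.ofReal κ⁻¹ * volume B ≤ 1 := by
    refine le_trans ?_ (prob_le_one (μ := gaussianVec n T) (s := B))
    rw [gaussianVec_eq_withDensity n hT, withDensity_apply _ hBm, ← setLIntegral_const]
    refine setLIntegral_mono (measurable_gaussianDensity n T).ennreal_ofReal fun y hy => ?_
    refine ENNReal.ofReal_le_ofReal ?_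
    rw [gaussianDensity, hκ, mul_inv, ← Real.exp_neg, Real.rpow_neg (by positivity)]
    have hy' : ‖y‖ ^ 2 / (2 * T) ≤ n / 2 := by
      rw [div_le_iff₀ (by positivity)]
      have : ‖y‖ ^ 2 ≤ n * T := hy
      linarith
    gcongr
  rw [ENNReal.ofReal_inv_of_pos hκ0, mul_comm, ← div_eq_mul_inv] at h1
  simpa using (ENNReal.div_le_iff (by simpa using hκ0) (by simp)).1 h1

/-- Apart from atypical noise of small norm, the density of the output is at most
`(2πv)^(-n/2) e^(-nθ/2)`. -/
lemma awgn_apply_le {n : ℕ} {v : ℝ} (hv : 0 < v) (θ T : ℝ) (u : Block n) {D : Set (Block n)}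
    (hD : MeasurableSet D) :
    awgn n v u D ≤
      ENNReal.ofReal ((2 * Real.pi * v) ^ (-(n / 2 : ℝ)) * Real.exp (-(n / 2 * θ))) *
          volume (D ∩ {y | ‖y‖ ^ 2 ≤ n * T}) +
        (gaussianVec n v {w | n * T ≤ ‖u + w‖ ^ 2} +
          gaussianVec n v {w | ‖w‖ ^ 2 ≤ n * (v * θ)}) := by
  have hBm : MeasurableSet {y : Block n | ‖y‖ ^ 2 ≤ n * T} :=
    measurableSet_le (by fun_prop) (by fun_prop)
  have hGm : MeasurableSet {w : Block n | n * (v * θ) ≤ ‖w‖ ^ 2} :=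
    measurableSet_le (by fun_prop) (by fun_prop)
  set S : Set (Block n) := (fun w => u + w) ⁻¹' (D ∩ {y | ‖y‖ ^ 2 ≤ n * T}) ∩
    {w | n * (v * θ) ≤ ‖w‖ ^ 2} with hS
  have hSm : MeasurableSet S := (measurable_const_add u (hD.inter hBm)).inter hGm
  rw [awgn_apply, Measure.map_apply (by fun_prop) hD]
  have hsub : (fun w => u + w) ⁻¹' D ⊆ S ∪
      ({w | n * T ≤ ‖u + w‖ ^ 2} ∪ {w | ‖w‖ ^ 2 ≤ n * (v * θ)}) := by
    intro w hw
    by_cases h1 : n * T ≤ ‖u + w‖ ^ 2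
    · exact Or.inr (Or.inl h1)
    by_cases h2 : ‖w‖ ^ 2 ≤ n * (v * θ)
    · exact Or.inr (Or.inr h2)
    exact Or.inl ⟨⟨hw, (not_le.1 h1).le⟩, (not_le.1 h2).le⟩
  refine (measure_mono hsub).trans ((measure_union_le _ _).trans
    (add_le_add ?_ (measure_union_le _ _)))
  rw [gaussianVec_eq_withDensity n hv, withDensity_apply _ hSm]
  refine le_trans (setLIntegral_mono measurable_const (g := fun _ =>
    ENNReal.ofReal ((2 * Real.pi * v) ^ (-(n / 2 : ℝ)) * Real.exp (-(n / 2 * θ))))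
    fun w hw => ENNReal.ofReal_le_ofReal ?_) ?_
  · rw [gaussianDensity]
    have hw' : n / 2 * θ ≤ ‖w‖ ^ 2 / (2 * v) := by
      rw [le_div_iff₀ (by positivity)]
      have : n * (v * θ) ≤ ‖w‖ ^ 2 := hw.2
      linarith
    gcongr
  · rw [setLIntegral_const]
    refine mul_le_mul_right ?_ _
    calc volume S ≤ volume ((fun w => u + w) ⁻¹' (D ∩ {y | ‖y‖ ^ 2 ≤ n * T})) :=
          measure_mono Set.inter_subset_left
      _ = _ := measure_preimage_add _ _ _

/-- Above capacity, the probability of correct decoding decreases exponentially: the noise spheres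
around the codewords do not fit into the ball that contains the channel output. -/
theorem awgn_strong_converse {v Q R : ℝ} (hv : 0 < v) (hQ : 0 ≤ Q)
    (hR : 1 / 2 * Real.logb 2 (1 + Q / v) < R) :
    ∃ c : ℝ, 0 < c ∧ ∀ (n M : ℕ), (2 : ℝ) ^ (R * n) ≤ M → ∀ (u : Fin M → Block n),
      (∀ m, ‖u m‖ ^ 2 ≤ n * Q) → ∀ d : Block n → Fin M, Measurable d →
        ∑ m, awgn n v (u m) {y | d y = m} ≤ M * ENNReal.ofReal (3 * Real.exp (-(c * n))) := by
  have hl2 : 0 < Real.log 2 := Real.log_pos (by norm_num)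
  set η : ℝ := R * Real.log 2 - 1 / 2 * Real.log ((Q + v) / v) with hη
  have hη0 : 0 < η := by
    have e : 1 + Q / v = (Q + v) / v := by field_simp; ring
    rw [e, Real.logb, mul_div_assoc', div_lt_iff₀ hl2] at hR
    linarith
  -- the margins in `θ` and `T` cost the exponent at most `3 η / 4` of the excess rate `η`
  set θ : ℝ := max (1 - η / 2) (1 / 2) with hθ
  have hθ1 : θ < 1 := max_lt (by linarith) (by norm_num)
  have hθ0 : 0 < θ := lt_of_lt_of_le (by norm_num) (le_max_right _ _)
  have hθη : 1 - η / 2 ≤ θ := le_max_left _ _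
  set T : ℝ := (Q + v) * Real.exp η with hTdef
  have hQv : 0 < Q + v := by linarith
  have hT : Q + v < T := by
    have : 1 < Real.exp η := Real.one_lt_exp_iff.2 hη0
    rw [hTdef]
    nlinarith
  have hT0 : 0 < T := hQv.trans hT
  obtain ⟨c1, hc1, hb1⟩ := exists_gaussianVec_norm_add_sq_ge_le hv hQ hT
  obtain ⟨c2, hc2, hb2⟩ := exists_gaussianVec_norm_sq_le_le hv hθ0 hθ1
  set c : ℝ := min (η / 4) (min c1 c2) with hc
  have hcη : c ≤ η / 4 := min_le_left _ _
  have hcc1 : c ≤ c1 := (min_le_right _ _).trans (min_le_left _ _)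
  have hcc2 : c ≤ c2 := (min_le_right _ _).trans (min_le_right _ _)
  refine ⟨c, lt_min (by linarith) (lt_min hc1 hc2), fun n M hM u hu d hd => ?_⟩
  have hn : (0 : ℝ) ≤ n := n.cast_nonneg
  set B : Set (Block n) := {y | ‖y‖ ^ 2 ≤ n * T} with hB
  set κ : ℝ := (2 * Real.pi * v) ^ (-(n / 2 : ℝ)) * Real.exp (-(n / 2 * θ)) with hκ
  have hDm : ∀ m, MeasurableSet {y | d y = m} := fun m => hd (measurableSet_singleton m)
  have hexp : ∀ {c'}, c ≤ c' → ENNReal.ofReal (Real.exp (-(c' * n))) ≤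
      ENNReal.ofReal (Real.exp (-(c * n))) := fun h =>
    ENNReal.ofReal_le_ofReal (Real.exp_le_exp.2 (by nlinarith))
  have hterm : ∀ m, awgn n v (u m) {y | d y = m} ≤
      ENNReal.ofReal κ * volume ({y | d y = m} ∩ B) +
        (ENNReal.ofReal (Real.exp (-(c * n))) + ENNReal.ofReal (Real.exp (-(c * n)))) :=
    fun m => (awgn_apply_le hv θ T (u m) (hDm m)).trans (by
      gcongr
      · exact (hb1 n (u m) (hu m)).trans (hexp hcc1)
      · exact (hb2 n).trans (hexp hcc2))
  have hvol : ∑ m, volume ({y | d y = m} ∩ B) ≤ volume B := by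
    have h := sum_measure_le_measure_univ (μ := volume.restrict B) (s := Finset.univ)
      (t := fun m => {y | d y = m}) (fun m _ => (hDm m).nullMeasurableSet)
      (fun i _ j _ hij => (Set.disjoint_left.2 fun y hi hj =>
        hij ((show d y = i from hi).symm.trans hj)).aedisjoint)
    rw [Measure.restrict_apply_univ] at h
    simpa only [Measure.restrict_apply (hDm _)] using h
  have hmain : κ * ((2 * Real.pi * T) ^ (n / 2 : ℝ) * Real.exp (n / 2)) ≤
      M * Real.exp (-(c * n)) := by
    have e : κ * ((2 * Real.pi * T) ^ (n / 2 : ℝ) * Real.exp (n / 2)) =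
        Real.exp (n / 2 * Real.log ((Q + v) / v) + n / 2 * η + n / 2 * (1 - θ)) := by
      have e1 : (2 * Real.pi * v) ^ (-(n / 2 : ℝ)) * (2 * Real.pi * T) ^ (n / 2 : ℝ) =
          Real.exp (n / 2 * Real.log ((Q + v) / v) + n / 2 * η) := by
        rw [Real.rpow_neg (by positivity), ← Real.inv_rpow (by positivity),
          ← Real.mul_rpow (by positivity) (by positivity)]
        have : (2 * Real.pi * v)⁻¹ * (2 * Real.pi * T) = (Q + v) / v * Real.exp η := by
          rw [hTdef]
          field_simp
        rw [this, Real.rpow_def_of_pos (by positivity), Real.log_mul (by positivity)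
          (by positivity), Real.log_exp]
        congr 1
        ring
      calc _ = ((2 * Real.pi * v) ^ (-(n / 2 : ℝ)) * (2 * Real.pi * T) ^ (n / 2 : ℝ)) *
            (Real.exp (-(n / 2 * θ)) * Real.exp (n / 2)) := by rw [hκ]; ring
        _ = _ := by
          rw [e1, ← Real.exp_add, ← Real.exp_add]
          congr 1
          ring
    rw [e]
    calc _ ≤ Real.exp (R * n * Real.log 2 + -(c * n)) := by
          refine Real.exp_le_exp.2 ?_
          have h3 : (n : ℝ) * c ≤ n * (η / 4) := mul_le_mul_of_nonneg_left hcη hn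
          have h4 : (n : ℝ) * (1 - η / 2) ≤ n * θ := mul_le_mul_of_nonneg_left hθη hn
          have h5 : (n : ℝ) * η = R * n * Real.log 2 - n / 2 * Real.log ((Q + v) / v) := by
            rw [hη]
            ring
          linarith
      _ = (2 : ℝ) ^ (R * n) * Real.exp (-(c * n)) := by
          rw [Real.exp_add, Real.rpow_def_of_pos (by norm_num)]
          ring_nf
      _ ≤ M * Real.exp (-(c * n)) := by gcongr
  have e0 : 0 ≤ Real.exp (-(c * n)) := (Real.exp_pos _).le
  calc ∑ m, awgn n v (u m) {y | d y = m}
      ≤ ∑ m, (ENNReal.ofReal κ * volume ({y | d y = m} ∩ B) +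
        (ENNReal.ofReal (Real.exp (-(c * n))) + ENNReal.ofReal (Real.exp (-(c * n))))) :=
        Finset.sum_le_sum fun m _ => hterm m
    _ = ENNReal.ofReal κ * ∑ m, volume ({y | d y = m} ∩ B) +
        M * ENNReal.ofReal (2 * Real.exp (-(c * n))) := by
        rw [Finset.sum_add_distrib, ← Finset.mul_sum, Finset.sum_const, Finset.card_univ,
          Fintype.card_fin, nsmul_eq_mul, ← ENNReal.ofReal_add e0 e0, two_mul]
    _ ≤ ENNReal.ofReal κ * ENNReal.ofReal ((2 * Real.pi * T) ^ (n / 2 : ℝ) * Real.exp (n / 2)) +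
        M * ENNReal.ofReal (2 * Real.exp (-(c * n))) := by
        gcongr
        exact hvol.trans (volume_norm_sq_le_le n hT0)
    _ ≤ M * ENNReal.ofReal (Real.exp (-(c * n))) +
        M * ENNReal.ofReal (2 * Real.exp (-(c * n))) := by
        refine add_le_add_left ?_ _
        rw [← ENNReal.ofReal_mul (by positivity), ← ENNReal.ofReal_natCast,
          ← ENNReal.ofReal_mul (by positivity)]
        exact ENNReal.ofReal_le_ofReal hmain
    _ = M * ENNReal.ofReal (3 * Real.exp (-(c * n))) := by
        rw [← mul_add, ← ENNReal.ofReal_add e0 (by positivity)]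
        ring_nf

/-! ### Capacity under the scale-and-babble attack -/

namespace Code

variable {n : ℕ} {P : ℝ} {A B K : RandomSource}

lemma measurable_error (C : Code n P A B K) (W : Kernel (Block n) (Block n)) [IsSFiniteKernel W]
    (m : Fin C.M) :
    Measurable (fun p : K.Ω × A.Ω × B.Ω =>
      W (C.enc m p.2.1 p.1) {y | C.dec y p.2.2 p.1 ≠ m}) := by
  have hg : Measurable (fun p : K.Ω × A.Ω × B.Ω => C.enc m p.2.1 p.1) :=
    (C.measurable_enc m).comp (by fun_prop : Measurable fun p : K.Ω × A.Ω × B.Ω => (p.2.1, p.1))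
  have hd : Measurable (fun q : (K.Ω × A.Ω × B.Ω) × Block n => C.dec q.2 q.1.2.2 q.1.1) :=
    C.measurable_dec.comp
      (by fun_prop : Measurable fun q : (K.Ω × A.Ω × B.Ω) × Block n => (q.2, q.1.2.2, q.1.1))
  exact Kernel.measurable_kernel_prodMk_left (κ := W.comap _ hg)
    (t := {q | C.dec q.2 q.1.2.2 q.1.1 ≠ m}) (hd (measurableSet_singleton m).compl)

lemma errorProb_eq (C : Code n P A B K) (W : Kernel (Block n) (Block n)) [IsSFiniteKernel W] :
    C.errorProb W = (∑ m : Fin C.M, ∫⁻ p : K.Ω × A.Ω × B.Ω,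
      W (C.enc m p.2.1 p.1) {y | C.dec y p.2.2 p.1 ≠ m}
        ∂(K.law.prod (A.law.prod B.law))) / C.M := by
  rw [errorProb]
  congr 1
  refine Finset.sum_congr rfl fun m _ => ?_
  have hm := C.measurable_error W m
  rw [lintegral_prod _ hm.aemeasurable]
  refine lintegral_congr fun k => ?_
  exact (lintegral_prod _ (hm.comp measurable_prodMk_left).aemeasurable).symm

/-- A lower bound for the error probability of all deterministic codes holds for randomized
codes. -/
lemma le_errorProb (C : Code n P A B K) (W : Kernel (Block n) (Block n)) [IsSFiniteKernel W]
    {e : ℝ≥0∞} (h : ∀ a b k, C.M * e ≤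
      ∑ m : Fin C.M, W (C.enc m a k) {y | C.dec y b k ≠ m}) : e ≤ C.errorProb W := by
  have hM : (C.M : ℝ≥0∞) ≠ 0 := by exact_mod_cast C.M_pos.ne'
  rw [errorProb_eq, ← lintegral_finsetSum _ fun m _ => C.measurable_error W m,
    ENNReal.le_div_iff_mul_le (Or.inl hM) (Or.inl (by simp)), mul_comm]
  calc C.M * e = ∫⁻ _ : K.Ω × A.Ω × B.Ω, C.M * e ∂(K.law.prod (A.law.prod B.law)) := by simp
    _ ≤ _ := lintegral_mono fun p => h _ _ _

lemma errorProb_le (C : Code n P A B K) (W : Kernel (Block n) (Block n)) {e : ℝ≥0∞}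
    (h : ∀ m, ∫⁻ k, ∫⁻ a, ∫⁻ b, W (C.enc m a k) {y | C.dec y b k ≠ m}
      ∂B.law ∂A.law ∂K.law ≤ e) : C.errorProb W ≤ e := by
  rw [errorProb]
  refine ENNReal.div_le_of_le_mul ((Finset.sum_le_sum fun m _ => h m).trans (le_of_eq ?_))
  rw [Finset.sum_const, Finset.card_univ, Fintype.card_fin, nsmul_eq_mul, mul_comm]

lemma two_rpow_le_M (C : Code n P A B K) {R : ℝ} (hn : 1 ≤ n) (hR : R ≤ C.rate) :
    (2 : ℝ) ^ (R * n) ≤ C.M := by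
  have hn' : (0 : ℝ) < n := by exact_mod_cast hn
  have hM : (0 : ℝ) < C.M := by exact_mod_cast C.M_pos
  rw [rate, le_div_iff₀ hn'] at hR
  exact (Real.le_logb_iff_rpow_le (by norm_num) hM).1 hR

end Code

/-- Where the attack vector is not scaled back, Bob faces a Gaussian channel; he cannot decode
reliably at a rate above its capacity, as that event has probability bounded below. -/
theorem capacity_scaleBabble_le {P N σ α v : ℝ} (hP : 0 ≤ P) (hv : 0 ≤ v)
    (hvα : 0 < α ^ 2 * σ ^ 2 + v) (h : α ^ 2 * (P + σ ^ 2) + v ≤ N)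
    (A B K : ℕ → RandomSource) :
    capacity P A B K (fun n => {jammed σ (scaleBabble n N α v)}) ≤
      ((1 / 2 * Real.logb 2 (1 + (1 - α) ^ 2 * P / (α ^ 2 * σ ^ 2 + v)) : ℝ) : EReal) := by
  refine sSup_le ?_
  rintro _ ⟨R, ⟨-, C, hrate, hlim⟩, rfl⟩
  rw [EReal.coe_le_coe_iff]
  by_contra! hR
  obtain ⟨c, hc, hconv⟩ := awgn_strong_converse hvα (mul_nonneg (sq_nonneg (1 - α)) hP) hR
  have hsmall : ∀ᶠ n : ℕ in atTop, 3 * Real.exp (-(c * n)) < 1 / 20000 := by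
    have : Tendsto (fun n : ℕ => 3 * Real.exp (-(c * n))) atTop (𝓝 (3 * 0)) :=
      (Real.tendsto_exp_neg_atTop_nhds_zero.comp
        (tendsto_natCast_atTop_atTop.const_mul_atTop hc)).const_mul 3
    rw [mul_zero] at this
    exact this.eventually (gt_mem_nhds (by norm_num))
  have herr : ∀ᶠ n : ℕ in atTop, (⨆ W ∈ ({jammed σ (scaleBabble n N α v)} :
      Set (Kernel (Block n) (Block n))), (C n).errorProb W) < ENNReal.ofReal (1 / 20000) :=
    hlim.eventually (gt_mem_nhds (by simp))
  obtain ⟨n, hs, he, hn⟩ := (hsmall.and (herr.and (eventually_ge_atTop 10000))).exists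
  have hd : ∀ b k, Measurable (fun y => (C n).dec y b k) := fun b k =>
    (C n).measurable_dec.comp (by fun_prop : Measurable fun y : Block n => (y, b, k))
  refine absurd he (not_lt.2 (le_trans ?_
    (le_iSup₂ (f := fun W _ => (C n).errorProb W) _ (Set.mem_singleton _))))
  refine (C n).le_errorProb _ fun a b k => ?_
  have hM := (C n).two_rpow_le_M (by omega) (hrate n (by omega))
  have hsucc := hconv n (C n).M hM (fun m => (1 - α) • (C n).enc m a k)
    (fun m => norm_smul_sq_le hP (1 - α) ((C n).power_le m a k)) _ (hd b k)
  have hone : ∀ m, (1 : ℝ≥0∞) ≤ jammed σ (scaleBabble n N α v) ((C n).enc m a k)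
      {y | (C n).dec y b k ≠ m} + (awgn n (α ^ 2 * σ ^ 2 + v) ((1 - α) • (C n).enc m a k)
        {y | (C n).dec y b k = m} + ENNReal.ofReal (9999 / 10000)) := by
    intro m
    have hE : MeasurableSet {y | (C n).dec y b k = m} := hd b k (measurableSet_singleton m)
    have h1 : jammed σ (scaleBabble n N α v) ((C n).enc m a k) {y | (C n).dec y b k ≠ m} +
        jammed σ (scaleBabble n N α v) ((C n).enc m a k) {y | (C n).dec y b k = m} = 1 := by
      rw [add_comm]
      exact prob_add_prob_compl hE
    rw [← h1]
    gcongr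
    refine (jammed_le_awgn_add hv N α _ hE).trans ?_
    gcongr
    refine (measure_clipEvent_le_sub hP hv hvα hn h ((C n).power_le m a k)).trans (le_of_eq ?_)
    rw [← ENNReal.ofReal_one, ← ENNReal.ofReal_sub _ (by norm_num)]
    norm_num
  have hsum := Finset.sum_le_sum fun m (_ : m ∈ Finset.univ) => hone m
  rw [Finset.sum_add_distrib, Finset.sum_add_distrib] at hsum
  simp only [Finset.sum_const, Finset.card_univ, Fintype.card_fin, nsmul_eq_mul] at hsum
  have hM' : ((C n).M : ℝ≥0∞) * 1 = (C n).M * ENNReal.ofReal (1 / 20000) +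
      ((C n).M * ENNReal.ofReal (1 / 20000) + (C n).M * ENNReal.ofReal (9999 / 10000)) := by
    rw [← mul_add, ← mul_add, ← ENNReal.ofReal_add (by norm_num) (by norm_num),
      ← ENNReal.ofReal_add (by norm_num) (by norm_num)]
    norm_num
  rw [hM'] at hsum
  refine ENNReal.le_of_add_le_add_right (by finiteness) (hsum.trans ?_)
  gcongr
  exact hsucc.trans (by gcongr)

/-! ### Reliable communication with a hidden Gaussian codebook -/

lemma isMarkovKernel_of_mem_jammers {n : ℕ} {N : ℝ} {J : Kernel (Block n) (Block n)}
    (hJ : J ∈ jammers n N) : IsMarkovKernel J := by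
  rw [jammers, Set.mem_ofPred_eq] at hJ
  exact hJ.1

lemma apply_compl_of_mem_jammers {n : ℕ} {N : ℝ} {J : Kernel (Block n) (Block n)}
    (hJ : J ∈ jammers n N) (z : Block n) :
    J z (Metric.closedBall 0 (Real.sqrt (n * N)))ᶜ = 0 := by
  rw [jammers, Set.mem_ofPred_eq] at hJ
  exact hJ.2 z

lemma measurable_kernel_section {α : Type*} [MeasurableSpace α] {n : ℕ}
    (W : Kernel (Block n) (Block n)) [IsSFiniteKernel W] {g : α → Block n} (hg : Measurable g)
    {t : Set (α × Block n)} (ht : MeasurableSet t) :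
    Measurable (fun p => W (g p) (Prod.mk p ⁻¹' t)) :=
  Kernel.measurable_kernel_prodMk_left (κ := W.comap g hg) ht

/-- The correlation of the codeword `x` with the output `x + s` is large for typical noise. Here `z`
is James' observation and `r = x - ρ z` the part of `x` that he cannot know. -/
lemma le_inner_add_of_typical {E : Type*} [NormedAddCommGroup E] [InnerProductSpace ℝ E]
    {n a S N ρ δ : ℝ} (hn : 0 ≤ n) (hρ : 0 ≤ ρ) (hδ : 0 ≤ δ) (hS : 0 ≤ S)
    (hgap : 2 * δ + ρ * Real.sqrt (S * (1 + δ) * N) ≤ a * (1 - δ)) {x z s : E}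
    (hx : n * (a * (1 - δ)) ≤ ‖x‖ ^ 2) (hz : ‖z‖ ^ 2 ≤ n * (S * (1 + δ)))
    (hs : ‖s‖ ≤ Real.sqrt (n * N)) (hr : inner ℝ (-s) (x - ρ • z) ≤ n * δ) :
    n * δ ≤ inner ℝ x (x + s) := by
  have h1 : ‖z‖ * ‖s‖ ≤ n * Real.sqrt (S * (1 + δ) * N) := by
    have hz' : ‖z‖ ≤ Real.sqrt (n * (S * (1 + δ))) := Real.le_sqrt_of_sq_le hz
    calc ‖z‖ * ‖s‖ ≤ Real.sqrt (n * (S * (1 + δ))) * Real.sqrt (n * N) :=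
          mul_le_mul hz' hs (norm_nonneg _) (Real.sqrt_nonneg _)
      _ = n * Real.sqrt (S * (1 + δ) * N) := by
          rw [← Real.sqrt_mul (by positivity),
            show n * (S * (1 + δ)) * (n * N) = n ^ 2 * (S * (1 + δ) * N) by ring,
            Real.sqrt_mul (by positivity), Real.sqrt_sq hn]
  have h2 : -(‖z‖ * ‖s‖) ≤ inner ℝ z s := (abs_le.1 (abs_real_inner_le_norm z s)).1
  have h3 : inner ℝ x (x + s) = ‖x‖ ^ 2 + ρ * inner ℝ z s - inner ℝ (-s) (x - ρ • z) := by
    rw [inner_add_right, real_inner_self_eq_norm_sq, inner_neg_left, inner_sub_right,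
      real_inner_smul_right, real_inner_comm s x, real_inner_comm s z]
    ring
  have h4 : ρ * (‖z‖ * ‖s‖) ≤ ρ * (n * Real.sqrt (S * (1 + δ) * N)) :=
    mul_le_mul_of_nonneg_left h1 hρ
  have h5 : ρ * -(‖z‖ * ‖s‖) ≤ ρ * inner ℝ z s := mul_le_mul_of_nonneg_left h2 hρ
  have h6 := mul_le_mul_of_nonneg_left hgap hn
  rw [h3]
  linarith

/-- An attack vector, chosen without knowledge of the Gaussian vector `r`, is nearly orthogonal to
`r` with high probability. -/
lemma lintegral_jammer_inner_le {n : ℕ} {N v δ : ℝ} (hN : 0 < N) (hv : 0 < v) (hδ : 0 < δ)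
    {J : Kernel (Block n) (Block n)} (hJ : J ∈ jammers n N) (z : Block n) :
    ∫⁻ r, J z {s | n * δ ≤ inner ℝ (-s) r} ∂gaussianVec n v ≤
      ENNReal.ofReal (Real.exp (-(δ ^ 2 / (2 * v * N) * n))) := by
  have := isMarkovKernel_of_mem_jammers hJ
  have ht : MeasurableSet {p : Block n × Block n | n * δ ≤ inner ℝ (-p.2) p.1} :=
    measurableSet_le (by fun_prop) (by fun_prop)
  have h := Measure.prod_apply (μ := gaussianVec n v) (ν := J z) ht
  rw [Measure.prod_apply_symm ht] at h
  refine (le_of_eq h.symm).trans ?_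
  calc ∫⁻ s, gaussianVec n v ((fun r => (r, s)) ⁻¹' {p : Block n × Block n |
          n * δ ≤ inner ℝ (-p.2) p.1}) ∂J z
      ≤ ∫⁻ _, ENNReal.ofReal (Real.exp (-(δ ^ 2 / (2 * v * N) * n))) ∂J z := by
        refine lintegral_mono_ae ?_
        have hb : ∀ᵐ s ∂J z, s ∈ Metric.closedBall (0 : Block n) (Real.sqrt (n * N)) :=
          mem_ae_iff.2 (apply_compl_of_mem_jammers hJ z)
        filter_upwards [hb] with s hs
        refine le_trans (le_of_eq rfl) (gaussianVec_inner_ge_le hv hN hδ (w := -s) ?_)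
        rw [norm_neg, ← Real.sq_sqrt (show (0 : ℝ) ≤ n * N by positivity)]
        rw [mem_closedBall_zero_iff] at hs
        gcongr
    _ = _ := by simp

/-- The channel output is well correlated with a Gaussian channel input. -/
theorem exists_missed_detection_le {a N σ δ : ℝ} (ha : 0 < a) (hN : 0 < N) (hσ : 0 < σ)
    (hδ : 0 < δ) (hδ1 : δ < 1)
    (hgap : 2 * δ + a / (a + σ ^ 2) * Real.sqrt ((a + σ ^ 2) * (1 + δ) * N) ≤ a * (1 - δ)) :
    ∃ c : ℝ, 0 < c ∧ ∀ (n : ℕ), ∀ J ∈ jammers n N,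
      ∫⁻ x, jammed σ J x {y | ¬ n * δ ≤ inner ℝ x y} ∂gaussianVec n a ≤
        ENNReal.ofReal (3 * Real.exp (-(c * n))) := by
  have hσ2 : 0 < σ ^ 2 := by positivity
  have hS : 0 < a + σ ^ 2 := by positivity
  set ρ : ℝ := a / (a + σ ^ 2) with hρ
  set v : ℝ := a * σ ^ 2 / (a + σ ^ 2) with hv
  have hv0 : 0 < v := by positivity
  obtain ⟨c1, hc1, hb1⟩ := exists_gaussianVec_norm_sq_le_le ha (θ := 1 - δ) (by linarith)
    (by linarith)
  obtain ⟨c2, hc2, hb2⟩ := exists_gaussianVec_norm_add_sq_ge_le (A := 0)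
    (T := (a + σ ^ 2) * (1 + δ)) hS le_rfl (by nlinarith)
  set c3 : ℝ := δ ^ 2 / (2 * v * N) with hc3
  have hc3' : 0 < c3 := by positivity
  set c : ℝ := min c1 (min c2 c3) with hc
  have hcc1 : c ≤ c1 := min_le_left _ _
  have hcc2 : c ≤ c2 := (min_le_right _ _).trans (min_le_left _ _)
  have hcc3 : c ≤ c3 := (min_le_right _ _).trans (min_le_right _ _)
  refine ⟨c, lt_min hc1 (lt_min hc2 hc3'), fun n J hJ => ?_⟩
  have := isMarkovKernel_of_mem_jammers hJ
  have hexp : ∀ {c'}, c ≤ c' → ENNReal.ofReal (Real.exp (-(c' * n))) ≤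
      ENNReal.ofReal (Real.exp (-(c * n))) := fun h =>
    ENNReal.ofReal_le_ofReal (Real.exp_le_exp.2 (by
      have : (0 : ℝ) ≤ n := n.cast_nonneg
      nlinarith))
  set μ : Measure (Block n × Block n) := (gaussianVec n a).prod (gaussianVec n (σ ^ 2)) with hμ
  set X : Set (Block n × Block n) := {p | ‖p.1‖ ^ 2 ≤ n * (a * (1 - δ))} with hX
  set Z : Set (Block n × Block n) := {p | n * ((a + σ ^ 2) * (1 + δ)) ≤ ‖p.1 + p.2‖ ^ 2} with hZ
  have hXm : MeasurableSet X := measurableSet_le (by fun_prop) (by fun_prop)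
  have hZm : MeasurableSet Z := measurableSet_le (by fun_prop) (by fun_prop)
  set F : Block n × Block n → ℝ≥0∞ := fun p =>
    J (p.1 + p.2) {s | n * δ ≤ inner ℝ (-s) (p.1 - ρ • (p.1 + p.2))} with hF
  have hFm : Measurable F :=
    measurable_kernel_section J (g := fun p : Block n × Block n => p.1 + p.2) (by fun_prop)
      (t := {q | n * δ ≤ inner ℝ (-q.2) (q.1.1 - ρ • (q.1.1 + q.1.2))})
      (measurableSet_le (by fun_prop) (by fun_prop))
  have hpt : ∀ p : Block n × Block n,
      J (p.1 + p.2) ((fun s => p.1 + s) ⁻¹' {y | ¬ n * δ ≤ inner ℝ p.1 y}) ≤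
        X.indicator 1 p + Z.indicator 1 p + F p := by
    intro p
    by_cases hpX : p ∈ X
    · rw [Set.indicator_of_mem hpX, add_assoc]
      exact prob_le_one.trans le_self_add
    by_cases hpZ : p ∈ Z
    · rw [Set.indicator_of_mem hpZ, add_comm _ ((1 : Block n × Block n → ℝ≥0∞) p), add_assoc]
      exact prob_le_one.trans le_self_add
    rw [Set.indicator_of_notMem hpX, Set.indicator_of_notMem hpZ, zero_add, zero_add]
    have hae : ∀ᵐ s ∂J (p.1 + p.2), s ∈ Metric.closedBall (0 : Block n) (Real.sqrt (n * N)) :=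
      mem_ae_iff.2 (apply_compl_of_mem_jammers hJ _)
    refine measure_mono_ae ?_
    filter_upwards [hae] with s hs hbad
    rw [mem_closedBall_zero_iff] at hs
    by_contra hr
    exact hbad (le_inner_add_of_typical n.cast_nonneg (by positivity) hδ.le hS.le hgap
      (not_le.1 hpX).le (not_le.1 hpZ).le hs (not_le.1 hr).le)
  have hXb : μ X ≤ ENNReal.ofReal (Real.exp (-(c * n))) := by
    have h : X = {x : Block n | ‖x‖ ^ 2 ≤ n * (a * (1 - δ))} ×ˢ Set.univ := by
      ext p
      simp [hX]
    rw [h, hμ, Measure.prod_prod, measure_univ, mul_one]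
    exact (hb1 n).trans (hexp hcc1)
  have hZb : μ Z ≤ ENNReal.ofReal (Real.exp (-(c * n))) := by
    have h := map_smul_add_smul_gaussianVec n ha.le hσ2.le 1 1
    simp only [one_smul, one_pow, one_mul] at h
    have h' := hb2 n 0 (by simp)
    simp only [zero_add] at h'
    have hT : MeasurableSet {u : Block n | n * ((a + σ ^ 2) * (1 + δ)) ≤ ‖u‖ ^ 2} :=
      measurableSet_le (by fun_prop) (by fun_prop)
    rw [← h, Measure.map_apply (by fun_prop) hT] at h'
    exact h'.trans (hexp hcc2)
  have hFb : ∫⁻ p, F p ∂μ ≤ ENNReal.ofReal (Real.exp (-(c * n))) := by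
    rw [hμ, gaussianVec_prod_eq_map n ha hσ2, lintegral_map hFm (by fun_prop), lintegral_prod]
    · have hin : ∀ z : Block n, ∫⁻ r, F (ρ • z + r, (σ ^ 2 / (a + σ ^ 2)) • z - r)
          ∂gaussianVec n v ≤ ENNReal.ofReal (Real.exp (-(c * n))) := by
        intro z
        refine le_trans (le_of_eq (lintegral_congr fun r => ?_))
          ((lintegral_jammer_inner_le hN hv0 hδ hJ z).trans (hexp hcc3))
        have e : ρ • z + r + ((σ ^ 2 / (a + σ ^ 2)) • z - r) = z := by
          have : ρ + σ ^ 2 / (a + σ ^ 2) = 1 := by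
            rw [hρ]
            field_simp
          calc _ = (ρ + σ ^ 2 / (a + σ ^ 2)) • z := by rw [add_smul]; abel
            _ = z := by rw [this, one_smul]
        simp only [hF, e, add_sub_cancel_left]
      calc _ ≤ ∫⁻ _ : Block n, ENNReal.ofReal (Real.exp (-(c * n)))
            ∂gaussianVec n (a + σ ^ 2) := lintegral_mono hin
        _ = _ := by simp
    · exact (hFm.comp (by fun_prop)).aemeasurable
  have htest : MeasurableSet {q : (Block n × Block n) × Block n |
      n * δ ≤ inner ℝ q.1.1 (q.1.1 + q.2)} := measurableSet_le (by fun_prop) (by fun_prop)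
  have hmeas : Measurable (fun p : Block n × Block n =>
      J (p.1 + p.2) ((fun s => p.1 + s) ⁻¹' {y | ¬ n * δ ≤ inner ℝ p.1 y})) :=
    measurable_kernel_section J (g := fun p : Block n × Block n => p.1 + p.2) (by fun_prop)
      htest.compl
  have hy : ∀ x : Block n, MeasurableSet {y : Block n | ¬ n * δ ≤ inner ℝ x y} := fun x =>
    (measurableSet_le (f := fun _ => n * δ) (g := fun y : Block n => inner ℝ x y)
      (by fun_prop) (by fun_prop)).compl
  calc ∫⁻ x, jammed σ J x {y | ¬ n * δ ≤ inner ℝ x y} ∂gaussianVec n a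
      = ∫⁻ p, J (p.1 + p.2) ((fun s => p.1 + s) ⁻¹' {y | ¬ n * δ ≤ inner ℝ p.1 y}) ∂μ := by
        rw [hμ, lintegral_prod _ hmeas.aemeasurable]
        exact lintegral_congr fun x => jammed_apply σ J x (hy x)
    _ ≤ ∫⁻ p, (X.indicator 1 p + Z.indicator 1 p + F p) ∂μ := lintegral_mono hpt
    _ = μ X + μ Z + ∫⁻ p, F p ∂μ := by
        rw [lintegral_add_right _ hFm, lintegral_add_left (measurable_one.indicator hXm),
          lintegral_indicator_one hXm, lintegral_indicator_one hZm]
    _ ≤ ENNReal.ofReal (Real.exp (-(c * n))) + ENNReal.ofReal (Real.exp (-(c * n))) +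
          ENNReal.ofReal (Real.exp (-(c * n))) := by gcongr
    _ = ENNReal.ofReal (3 * Real.exp (-(c * n))) := by
        rw [← ENNReal.ofReal_add (by positivity) (by positivity),
          ← ENNReal.ofReal_add (by positivity) (by positivity)]
        ring_nf

/-- A Gaussian vector that is independent of the channel input and the noise is nearly orthogonal to
the channel output. -/
theorem lintegral_false_alarm_le {n : ℕ} {a P N σ δ : ℝ} (ha : 0 < a) (hP : 0 < P) (hN : 0 < N)
    (hδ : 0 < δ) {J : Kernel (Block n) (Block n)} (hJ : J ∈ jammers n N) {x : Block n}
    (hx : ‖x‖ ≤ Real.sqrt (n * P)) :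
    ∫⁻ x', jammed σ J x {y | n * δ ≤ inner ℝ x' y} ∂gaussianVec n a ≤
      ENNReal.ofReal (Real.exp
        (-(δ ^ 2 / (2 * a * (Real.sqrt P + Real.sqrt N) ^ 2) * n))) := by
  have := isMarkovKernel_of_mem_jammers hJ
  set L : ℝ := (Real.sqrt P + Real.sqrt N) ^ 2 with hL
  have hL0 : 0 < L := by positivity
  have ht : MeasurableSet {p : Block n × Block n | n * δ ≤ inner ℝ p.1 p.2} :=
    measurableSet_le (by fun_prop) (by fun_prop)
  have hfar : jammed σ J x {y | ‖y‖ ^ 2 ≤ n * L}ᶜ = 0 := by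
    rw [jammed_apply _ _ _ (measurableSet_le (by fun_prop) (by fun_prop)).compl]
    refine (lintegral_congr fun w => ?_).trans lintegral_zero
    refine measure_mono_null (fun s hs => ?_) (apply_compl_of_mem_jammers hJ (x + w))
    refine fun hs' => hs ?_
    rw [mem_closedBall_zero_iff] at hs'
    have h : ‖x + s‖ ≤ Real.sqrt n * (Real.sqrt P + Real.sqrt N) := by
      refine (norm_add_le _ _).trans ((add_le_add hx hs').trans (le_of_eq ?_))
      rw [Real.sqrt_mul (by positivity), Real.sqrt_mul (by positivity), mul_add]
    calc ‖x + s‖ ^ 2 ≤ (Real.sqrt n * (Real.sqrt P + Real.sqrt N)) ^ 2 := by gcongr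
      _ = n * L := by rw [mul_pow, Real.sq_sqrt (by positivity)]
  have h := Measure.prod_apply (μ := gaussianVec n a) (ν := jammed σ J x) ht
  rw [Measure.prod_apply_symm ht] at h
  refine (le_of_eq h.symm).trans ?_
  calc ∫⁻ y, gaussianVec n a ((fun x' => (x', y)) ⁻¹' {p : Block n × Block n |
          n * δ ≤ inner ℝ p.1 p.2}) ∂jammed σ J x
      ≤ ∫⁻ _, ENNReal.ofReal (Real.exp (-(δ ^ 2 / (2 * a * L) * n))) ∂jammed σ J x := by
        refine lintegral_mono_ae ?_
        have hb : ∀ᵐ y ∂jammed σ J x, y ∈ {y : Block n | ‖y‖ ^ 2 ≤ n * L} := mem_ae_iff.2 hfar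
        filter_upwards [hb] with y hy
        refine le_trans (le_of_eq ?_) (gaussianVec_inner_ge_le ha hL0 hδ (w := y) hy)
        congr 1
        ext x'
        exact iff_of_eq (congrArg _ (real_inner_comm _ _))
    _ = _ := by simp

/-- A codebook of `M` independent codewords with law `𝒩(0, a Iₙ)`, as common randomness. -/
def gaussianCodebook (n M : ℕ) (a : ℝ) : RandomSource where
  Ω := Fin M → Block n
  law := Measure.pi fun _ => gaussianVec n a

/-- The codeword `x`, or `0` where `x` exceeds the power `P`. -/
def truncate (n : ℕ) (P : ℝ) (x : Block n) : Block n :=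
  open Classical in
  if ‖x‖ ≤ Real.sqrt (n * P) then x else 0

lemma measurable_truncate (n : ℕ) (P : ℝ) : Measurable (truncate n P) := by
  unfold truncate
  exact Measurable.ite (measurableSet_le (by fun_prop) (by fun_prop)) (by fun_prop) (by fun_prop)

lemma norm_truncate_le {n : ℕ} (P : ℝ) (x : Block n) :
    ‖truncate n P x‖ ≤ Real.sqrt (n * P) := by
  unfold truncate
  split_ifs with h
  · exact h
  · rw [norm_zero]
    exact Real.sqrt_nonneg _

/-- Some message that passes the test `S`, or `0` if there is none. -/
def pickMessage {M : ℕ} (hM : 0 < M) (S : Fin M → Prop) : Fin M :=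
  open Classical in
  if h : ∃ m, S m then h.choose else ⟨0, hM⟩

lemma pickMessage_eq {M : ℕ} (hM : 0 < M) {S : Fin M → Prop} {m : Fin M} (hm : S m)
    (hne : ∀ m', m' ≠ m → ¬ S m') : pickMessage hM S = m := by
  have h : ∃ m, S m := ⟨m, hm⟩
  rw [pickMessage, dif_pos h]
  by_contra hc
  exact hne _ hc h.choose_spec

/-- The random Gaussian code. The decoder accepts a message if the correlation of its codeword with
the channel output is at least `nδ`. -/
def gaussianCode (n : ℕ) {M : ℕ} (hM : 0 < M) (P a δ : ℝ) (A B : RandomSource) :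
    Code n P A B (gaussianCodebook n M a) where
  M := M
  M_pos := hM
  enc m _ k := truncate n P (k m)
  measurable_enc m := (measurable_truncate n P).comp ((measurable_pi_apply m).comp measurable_snd)
  power_le m _ k := norm_truncate_le P (k m)
  dec y _ k := pickMessage hM fun m => n * δ ≤ inner ℝ (k m) y
  measurable_dec := by
    refine (measurable_of_finite (pickMessage hM)).comp (measurable_pi_lambda _ fun m => ?_)
    have hk : Measurable fun p : Block n × B.Ω × (gaussianCodebook n M a).Ω => p.2.2 m :=
      (measurable_pi_apply m).comp (measurable_snd.comp measurable_snd)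
    have hy : Measurable fun p : Block n × B.Ω × (gaussianCodebook n M a).Ω => p.1 :=
      measurable_fst
    exact measurableSet_setOfPred.1 (measurableSet_le measurable_const (hk.inner hy))

lemma map_pi_pair {ι E : Type*} [Fintype ι] [MeasurableSpace E] (μ : Measure E)
    [IsProbabilityMeasure μ] {i j : ι} (h : i ≠ j) :
    (Measure.pi fun _ : ι => μ).map (fun k => (k i, k j)) = μ.prod μ := by
  have hind : IndepFun (fun k : ι → E => k i) (fun k => k j) (Measure.pi fun _ : ι => μ) :=
    (iIndepFun_pi (μ := fun _ : ι => μ) (X := fun _ => id) (fun _ => aemeasurable_id)).indepFun h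
  rw [indepFun_iff_map_prod_eq_prod_map_map (measurable_pi_apply i).aemeasurable
    (measurable_pi_apply j).aemeasurable] at hind
  have hi : ∀ i : ι, (Measure.pi fun _ : ι => μ).map (fun k => k i) = μ := fun i =>
    (measurePreserving_eval (fun _ : ι => μ) i).map_eq
  rwa [hi, hi] at hind

lemma measurable_correlation_test {α : Type*} [MeasurableSpace α] {n : ℕ}
    (W : Kernel (Block n) (Block n)) [IsSFiniteKernel W] {P τ : ℝ} {g h : α → Block n}
    (hg : Measurable g) (hh : Measurable h) :
    Measurable (fun p => W (truncate n P (g p)) {y | τ ≤ inner ℝ (h p) y}) :=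
  measurable_kernel_section W ((measurable_truncate n P).comp hg)
    (t := {q | τ ≤ inner ℝ (h q.1) q.2})
    (measurableSet_le (by fun_prop) ((hh.comp measurable_fst).inner measurable_snd))

/-- The union bound over the transmitted message and its competitors. -/
lemma errorProb_gaussianCode_le {n M : ℕ} (hM : 0 < M) {P a δ : ℝ} (A B : RandomSource)
    (W : Kernel (Block n) (Block n)) [IsMarkovKernel W] {e₁ e₂ : ℝ≥0∞}
    (h₁ : ∫⁻ x, W (truncate n P x) {y | ¬ n * δ ≤ inner ℝ x y} ∂gaussianVec n a ≤ e₁)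
    (h₂ : ∀ x, ∫⁻ x', W (truncate n P x) {y | n * δ ≤ inner ℝ x' y} ∂gaussianVec n a ≤ e₂) :
    (gaussianCode n hM P a δ A B).errorProb W ≤ e₁ + M * e₂ := by
  have key : ∀ m : Fin M, ∫⁻ k, ∫⁻ a', ∫⁻ b, W ((gaussianCode n hM P a δ A B).enc m a' k)
      {y | (gaussianCode n hM P a δ A B).dec y b k ≠ m}
        ∂B.law ∂A.law ∂(gaussianCodebook n M a).law ≤ e₁ + M * e₂ := by
    intro m
    set ν : Measure (Fin M → Block n) := Measure.pi fun _ => gaussianVec n a with hν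
    set f : (Fin M → Block n) → ℝ≥0∞ := fun k =>
      W (truncate n P (k m)) {y | ¬ n * δ ≤ inner ℝ (k m) y} with hf
    set g : Fin M → (Fin M → Block n) → ℝ≥0∞ := fun m' k =>
      W (truncate n P (k m)) {y | n * δ ≤ inner ℝ (k m') y} with hg
    have hgm : ∀ m', Measurable (g m') := fun m' =>
      measurable_correlation_test W (measurable_pi_apply m) (measurable_pi_apply m')
    have hpt : ∀ k : Fin M → Block n, W (truncate n P (k m))
        {y | pickMessage hM (fun m' => n * δ ≤ inner ℝ (k m') y) ≠ m} ≤
          f k + ∑ m' ∈ Finset.univ.erase m, g m' k := by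
      intro k
      refine (measure_mono (t := {y | ¬ n * δ ≤ inner ℝ (k m) y} ∪
        ⋃ m' ∈ Finset.univ.erase m, {y | n * δ ≤ inner ℝ (k m') y}) fun y hy => ?_).trans
          ((measure_union_le _ _).trans (add_le_add le_rfl (measure_biUnion_finset_le _ _)))
      by_contra hc
      simp only [Set.mem_union, Set.mem_iUnion, not_or, not_exists] at hc
      exact hy (pickMessage_eq hM (not_not.1 hc.1) fun m' hm' =>
        hc.2 m' (Finset.mem_erase.2 ⟨hm', Finset.mem_univ _⟩))
    have hfint : ∫⁻ k, f k ∂ν ≤ e₁ := by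
      refine le_trans (le_of_eq ?_) h₁
      have hmeas : Measurable fun x : Block n =>
          W (truncate n P x) {y | ¬ n * δ ≤ inner ℝ x y} :=
        measurable_kernel_section W (measurable_truncate n P)
          (measurableSet_le (f := fun _ : Block n × Block n => n * δ)
            (g := fun q : Block n × Block n => inner ℝ q.1 q.2)
            (by fun_prop) (by fun_prop)).compl
      exact (measurePreserving_eval (fun _ : Fin M => gaussianVec n a) m).lintegral_comp hmeas
    have hgint : ∀ m' ∈ Finset.univ.erase m, ∫⁻ k, g m' k ∂ν ≤ e₂ := by
      intro m' hm'
      have hne : m ≠ m' := (Finset.ne_of_mem_erase hm').symm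
      have hmeas : Measurable fun p : Block n × Block n =>
          W (truncate n P p.1) {y | n * δ ≤ inner ℝ p.2 y} :=
        measurable_correlation_test W measurable_fst measurable_snd
      have h := lintegral_map (μ := ν) hmeas (g := fun k => (k m, k m')) (by fun_prop)
      rw [hν, map_pi_pair _ hne, lintegral_prod _ hmeas.aemeasurable] at h
      rw [hν]
      refine (le_of_eq h.symm).trans ?_
      calc _ ≤ ∫⁻ _ : Block n, e₂ ∂gaussianVec n a := lintegral_mono h₂
        _ = e₂ := by simp
    calc _ = ∫⁻ k, W (truncate n P (k m))
          {y | pickMessage hM (fun m' => n * δ ≤ inner ℝ (k m') y) ≠ m} ∂ν := by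
          refine lintegral_congr fun k => ?_
          simp only [gaussianCode, lintegral_const, measure_univ, mul_one]
      _ ≤ ∫⁻ k, (f k + ∑ m' ∈ Finset.univ.erase m, g m' k) ∂ν := lintegral_mono hpt
      _ = ∫⁻ k, f k ∂ν + ∑ m' ∈ Finset.univ.erase m, ∫⁻ k, g m' k ∂ν := by
          rw [lintegral_add_right _ (Finset.measurable_fun_sum _ fun m' _ => hgm m'),
            lintegral_finsetSum _ fun m' _ => hgm m']
      _ ≤ e₁ + ∑ m' ∈ Finset.univ.erase m, e₂ := add_le_add hfint (Finset.sum_le_sum hgint)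
      _ ≤ e₁ + M * e₂ := by
          rw [Finset.sum_const, nsmul_eq_mul]
          gcongr
          exact (Finset.card_le_univ _).trans (by simp)
  exact Code.errorProb_le _ _ key

/-- The margin of the correlation test, positive where `N < P + σ²`. -/
lemma exists_test_margin {P N σ : ℝ} (hP : 0 < P) (hσ : 0 < σ) (h : N < P + σ ^ 2) :
    ∃ a δ : ℝ, 0 < a ∧ a < P ∧ 0 < δ ∧ δ < 1 ∧
      2 * δ + a / (a + σ ^ 2) * Real.sqrt ((a + σ ^ 2) * (1 + δ) * N) ≤ a * (1 - δ) := by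
  obtain ⟨a, ha, haP⟩ : ∃ a, max 0 (N - σ ^ 2) < a ∧ a < P :=
    exists_between (max_lt hP (by linarith))
  have ha0 : 0 < a := (le_max_left _ _).trans_lt ha
  have haN : N < a + σ ^ 2 := by linarith [(le_max_right 0 (N - σ ^ 2)).trans_lt ha]
  have hS : 0 < a + σ ^ 2 := by positivity
  have hlim : Tendsto (fun δ : ℝ => a * (1 - δ) -
      (2 * δ + a / (a + σ ^ 2) * Real.sqrt ((a + σ ^ 2) * (1 + δ) * N))) (𝓝[>] 0)
      (𝓝 (a * (1 - 0) -
        (2 * 0 + a / (a + σ ^ 2) * Real.sqrt ((a + σ ^ 2) * (1 + 0) * N)))) := by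
    refine Tendsto.mono_left (Continuous.tendsto ?_ 0) nhdsWithin_le_nhds
    fun_prop
  have hpos : 0 < a * (1 - 0) -
      (2 * 0 + a / (a + σ ^ 2) * Real.sqrt ((a + σ ^ 2) * (1 + 0) * N)) := by
    have hsqrt : Real.sqrt ((a + σ ^ 2) * N) < a + σ ^ 2 := by
      rw [Real.sqrt_lt' hS]
      nlinarith
    have : a / (a + σ ^ 2) * Real.sqrt ((a + σ ^ 2) * N) < a / (a + σ ^ 2) * (a + σ ^ 2) :=
      mul_lt_mul_of_pos_left hsqrt (by positivity)
    rw [div_mul_cancel₀ _ hS.ne'] at this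
    simp only [sub_zero, mul_one, mul_zero, zero_add, add_zero]
    linarith
  obtain ⟨δ, hδ, hδ0, hδ1⟩ := ((hlim.eventually (lt_mem_nhds hpos)).and
    (Ioo_mem_nhdsGT (show (0 : ℝ) < 1 by norm_num))).exists
  exact ⟨a, δ, ha0, haP, hδ0, hδ1, by linarith⟩

/-- If the power of James' observation exceeds his own, a positive rate is achievable with enough
common randomness. -/
theorem exists_achievable {P N σ : ℝ} (hP : 0 < P) (hN : 0 < N) (hσ : 0 < σ)
    (h : N < P + σ ^ 2) (A B : ℕ → RandomSource) :
    ∃ (K : ℕ → RandomSource) (R : ℝ), 0 < R ∧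
      Achievable P A B K (fun n => {W | ∃ J ∈ jammers n N, W = jammed σ J}) R := by
  obtain ⟨a, δ, ha, haP, hδ, hδ1, hgap⟩ := exists_test_margin hP hσ h
  obtain ⟨c1, hc1, hb1⟩ := exists_missed_detection_le ha hN hσ hδ hδ1 hgap
  obtain ⟨c2, hc2, hb2⟩ := exists_gaussianVec_norm_add_sq_ge_le (A := 0) (T := P) ha le_rfl
    (by linarith)
  set c3 : ℝ := δ ^ 2 / (2 * a * (Real.sqrt P + Real.sqrt N) ^ 2) with hc3
  have hPs : 0 < Real.sqrt P := Real.sqrt_pos.2 hP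
  have hc3' : 0 < c3 := by positivity
  have hl2 : 0 < Real.log 2 := Real.log_pos (by norm_num)
  -- half the exponent of a false alarm is left for the union bound over the messages
  set R : ℝ := c3 / (2 * Real.log 2) with hR
  have hR0 : 0 < R := by positivity
  set M : ℕ → ℕ := fun n => ⌈(2 : ℝ) ^ (R * n)⌉₊ with hM
  have hMpos : ∀ n, 0 < M n := fun n => Nat.ceil_pos.2 (by positivity)
  refine ⟨fun n => gaussianCodebook n (M n) a, R, hR0,
    fun n => gaussianCode n (hMpos n) P a δ (A n) (B n), fun n hn => ?_, ?_⟩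
  · have hn' : (0 : ℝ) < n := by exact_mod_cast hn
    rw [Code.rate, le_div_iff₀ hn']
    have hMn : (0 : ℝ) < M n := by exact_mod_cast hMpos n
    exact (Real.le_logb_iff_rpow_le (by norm_num) hMn).2 (Nat.le_ceil _)
  · have hbound : ∀ n : ℕ, (⨆ W ∈ {W | ∃ J ∈ jammers n N, W = jammed σ J},
        (gaussianCode n (hMpos n) P a δ (A n) (B n)).errorProb W) ≤
        ENNReal.ofReal (Real.exp (-(c2 * n)) + 3 * Real.exp (-(c1 * n)) +
          2 * Real.exp (-(c3 / 2 * n))) := by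
      intro n
      refine iSup₂_le ?_
      rintro _ ⟨J, hJ, rfl⟩
      have := isMarkovKernel_of_mem_jammers hJ
      have hX : MeasurableSet {x : Block n | n * P ≤ ‖x‖ ^ 2} :=
        measurableSet_le (by fun_prop) (by fun_prop)
      have h₁ : ∫⁻ x, jammed σ J (truncate n P x) {y | ¬ n * δ ≤ inner ℝ x y}
          ∂gaussianVec n a ≤
            ENNReal.ofReal (Real.exp (-(c2 * n)) + 3 * Real.exp (-(c1 * n))) := by
        calc _ ≤ ∫⁻ x, ({x : Block n | n * P ≤ ‖x‖ ^ 2}.indicator 1 x +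
              jammed σ J x {y | ¬ n * δ ≤ inner ℝ x y}) ∂gaussianVec n a := by
              refine lintegral_mono fun x => ?_
              by_cases hx : ‖x‖ ≤ Real.sqrt (n * P)
              · rw [truncate, if_pos hx]
                exact le_add_self
              · rw [Set.indicator_of_mem]
                · exact prob_le_one.trans le_self_add
                · exact ((Real.sqrt_lt' ((Real.sqrt_nonneg _).trans_lt (not_le.1 hx))).1
                    (not_le.1 hx)).le
          _ = gaussianVec n a {x | n * P ≤ ‖x‖ ^ 2} +
              ∫⁻ x, jammed σ J x {y | ¬ n * δ ≤ inner ℝ x y} ∂gaussianVec n a := by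
              rw [lintegral_add_left (measurable_one.indicator hX), lintegral_indicator_one hX]
          _ ≤ ENNReal.ofReal (Real.exp (-(c2 * n))) +
              ENNReal.ofReal (3 * Real.exp (-(c1 * n))) := by
              gcongr
              · simpa using hb2 n 0 (by simp)
              · exact hb1 n J hJ
          _ = _ := (ENNReal.ofReal_add (by positivity) (by positivity)).symm
      refine (errorProb_gaussianCode_le (hMpos n) (A n) (B n) (jammed σ J) h₁ fun x =>
        lintegral_false_alarm_le ha hP hN hδ hJ (norm_truncate_le P x)).trans ?_
      rw [ENNReal.ofReal_add (p := _ + _) (by positivity) (by positivity)]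
      gcongr
      rw [← ENNReal.ofReal_natCast, ← ENNReal.ofReal_mul (by positivity)]
      refine ENNReal.ofReal_le_ofReal ?_
      have hone : (1 : ℝ) ≤ (2 : ℝ) ^ (R * n) :=
        Real.one_le_rpow (by norm_num) (by positivity)
      have hceil : (M n : ℝ) ≤ 2 * (2 : ℝ) ^ (R * n) := by
        have := Nat.ceil_lt_add_one (show (0 : ℝ) ≤ (2 : ℝ) ^ (R * n) by positivity)
        simp only [hM]
        linarith
      have hpow : (2 : ℝ) ^ (R * n) = Real.exp (c3 / 2 * n) := by
        rw [Real.rpow_def_of_pos (by norm_num), hR]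
        congr 1
        field_simp
      calc (M n : ℝ) * Real.exp (-(c3 * n)) ≤
            2 * Real.exp (c3 / 2 * n) * Real.exp (-(c3 * n)) := by
            rw [hpow] at hceil
            gcongr
        _ = 2 * Real.exp (-(c3 / 2 * n)) := by
            rw [mul_assoc, ← Real.exp_add]
            ring_nf
    refine tendsto_of_tendsto_of_tendsto_of_le_of_le tendsto_const_nhds ?_ (fun _ => zero_le)
      hbound
    have hexp : ∀ {c : ℝ}, 0 < c → Tendsto (fun n : ℕ => Real.exp (-(c * n))) atTop (𝓝 0) :=
      fun hc => Real.tendsto_exp_neg_atTop_nhds_zero.comp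
        (tendsto_natCast_atTop_atTop.const_mul_atTop hc)
    have hsum := ((hexp hc2).add ((hexp hc1).const_mul 3)).add
      ((hexp (half_pos hc3')).const_mul 2)
    simpa using ENNReal.tendsto_ofReal hsum

/-! ### Bounds on the capacity of the myopic channel -/

lemma capacity_anti {P : ℝ} {A B K : ℕ → RandomSource}
    {𝒲 𝒲' : ∀ n, Set (Kernel (Block n) (Block n))} (h : ∀ n, 𝒲 n ⊆ 𝒲' n) :
    capacity P A B K 𝒲' ≤ capacity P A B K 𝒲 := by
  refine sSup_le_sSup (Set.image_mono ?_)
  rintro R ⟨hR, C, hrate, hlim⟩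
  exact ⟨hR, C, hrate, tendsto_of_tendsto_of_tendsto_of_le_of_le tendsto_const_nhds hlim
    (fun _ => zero_le) fun n => biSup_mono fun W hW => h n hW⟩

/-- The code with a single message. -/
def trivialCode (n : ℕ) (P : ℝ) (A B K : RandomSource) : Code n P A B K where
  M := 1
  M_pos := one_pos
  enc _ _ _ := 0
  measurable_enc _ := measurable_const
  power_le _ _ _ := by
    rw [norm_zero]
    exact Real.sqrt_nonneg _
  dec _ _ _ := 0
  measurable_dec := measurable_const

lemma errorProb_trivialCode (n : ℕ) (P : ℝ) (A B K : RandomSource)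
    (W : Kernel (Block n) (Block n)) : (trivialCode n P A B K).errorProb W = 0 := by
  refine le_antisymm (Code.errorProb_le _ _ fun m => ?_) zero_le
  have h : ∀ (y : Block n) b k, (trivialCode n P A B K).dec y b k = m := fun y b k =>
    Subsingleton.elim (α := Fin 1) _ _
  simp [h]

lemma capacity_nonneg (P : ℝ) (A B K : ℕ → RandomSource)
    (𝒲 : ∀ n, Set (Kernel (Block n) (Block n))) : 0 ≤ capacity P A B K 𝒲 := by
  refine le_sSup ⟨0, ⟨le_rfl, fun n => trivialCode n P (A n) (B n) (K n), fun n _ => ?_, ?_⟩, rfl⟩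
  · simp [Code.rate, trivialCode]
  · simp [errorProb_trivialCode]

lemma sub_sq_mul_pos {P N σ α : ℝ} (hP : 0 < P) (hN : 0 < N) (hσ : 0 < σ)
    (hα : α ∈ Set.Ioc 0 (Real.sqrt (N / (P + σ ^ 2)))) : 0 < N - α ^ 2 * P := by
  have h := sq_mul_le_of_le_sqrt hP hN hα.1.le hα.2
  have : 0 < α ^ 2 * σ ^ 2 := by
    have := hα.1
    positivity
  linarith

/-- The bound for the scale-and-babble attack, as the babble approaches full power. -/
theorem myopicCapacity_le_attackRate {P N σ α : ℝ} (hP : 0 < P) (hN : 0 < N) (hσ : 0 < σ)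
    (hα : α ∈ Set.Ioc 0 (Real.sqrt (N / (P + σ ^ 2)))) (A B K : ℕ → RandomSource) :
    myopicCapacity P N σ A B K ≤ (attackRate P N α : EReal) := by
  have hle := sq_mul_le_of_le_sqrt hP hN hα.1.le hα.2
  have hpos := sub_sq_mul_pos hP hN hσ hα
  have hασ : 0 < α ^ 2 * σ ^ 2 := by
    have := hα.1
    positivity
  have e0 : α ^ 2 * σ ^ 2 + babbleVar P N σ α 0 = N - α ^ 2 * P := by
    unfold babbleVar
    ring
  have hlim : Tendsto (fun ε => 1 / 2 * Real.logb 2 (1 + (1 - α) ^ 2 * P /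
      (α ^ 2 * σ ^ 2 + babbleVar P N σ α ε))) (𝓝[>] 0) (𝓝 (attackRate P N α)) := by
    refine Tendsto.mono_left ?_ nhdsWithin_le_nhds
    have hc : ContinuousAt (fun ε => 1 / 2 * Real.logb 2 (1 + (1 - α) ^ 2 * P /
        (α ^ 2 * σ ^ 2 + babbleVar P N σ α ε))) 0 := by
      refine continuousAt_const.mul (ContinuousAt.div_const (ContinuousAt.log
        (continuousAt_const.add (continuousAt_const.div ?_ ?_)) ?_) _)
      · unfold babbleVar
        fun_prop
      · rw [e0]
        exact hpos.ne'
      · change 1 + (1 - α) ^ 2 * P / (α ^ 2 * σ ^ 2 + babbleVar P N σ α 0) ≠ 0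
        rw [e0]
        positivity
    have := hc.tendsto
    rwa [e0] at this
  refine ge_of_tendsto ((continuous_coe_real_ereal.tendsto _).comp hlim) ?_
  filter_upwards [Ioo_mem_nhdsGT (show (0 : ℝ) < 1 by norm_num)] with ε hε
  have hv := babbleVar_nonneg hle hε.2
  have hsub : ∀ n, {jammed σ (scaleBabble n N α (babbleVar P N σ α ε))} ⊆
      {W | ∃ J ∈ jammers n N, W = jammed σ J} := fun n => by
    rintro _ rfl
    exact ⟨_, scaleBabble_mem_jammers n N α _, rfl⟩
  refine (capacity_anti hsub).trans (capacity_scaleBabble_le hP.le hv (by linarith) ?_ A B K)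
  unfold babbleVar
  nlinarith [hε.1]

/-! ### The optimal attack -/

lemma attackRate_le_attackRate {P N α β : ℝ} (hP : 0 < P) (hα : 0 < N - α ^ 2 * P)
    (h : (1 - α) ^ 2 * P / (N - α ^ 2 * P) ≤ (1 - β) ^ 2 * P / (N - β ^ 2 * P)) :
    attackRate P N α ≤ attackRate P N β := by
  unfold attackRate
  have : 0 ≤ (1 - α) ^ 2 * P / (N - α ^ 2 * P) := by positivity
  have := Real.logb_le_logb_of_le (b := 2) (by norm_num)
    (by linarith : 0 < 1 + (1 - α) ^ 2 * P / (N - α ^ 2 * P)) (add_le_add_right h 1)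
  linarith

/-- Unconstrained, the minimum over `α` is at `α = N / P`. -/
theorem isLeast_rateLD {P N σ : ℝ} (hP : 0 < P) (hN : 0 < N) (hσ : 0 < σ)
    (h : N * (P + σ ^ 2) ≤ P ^ 2) :
    IsLeast (attackRate P N '' Set.Ioc 0 (Real.sqrt (N / (P + σ ^ 2)))) (rateLD P N) := by
  have hS : 0 < P + σ ^ 2 := by positivity
  have hNP : N < P := by
    by_contra! hc
    have : 0 < σ ^ 2 := by positivity
    nlinarith
  have hmem : N / P ∈ Set.Ioc 0 (Real.sqrt (N / (P + σ ^ 2))) := by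
    refine ⟨by positivity, Real.le_sqrt_of_sq_le ?_⟩
    rw [div_pow, div_le_div_iff₀ (by positivity) hS]
    nlinarith
  have hd : N - (N / P) ^ 2 * P = N * (P - N) / P := by field_simp
  have hv : attackRate P N (N / P) = rateLD P N := by
    have : 0 < P - N := by linarith
    rw [attackRate, rateLD, hd]
    congr 2
    field_simp
    ring
  refine ⟨⟨_, hmem, hv⟩, ?_⟩
  rintro _ ⟨α, hα, rfl⟩
  have hpos := sub_sq_mul_pos hP hN hσ hα
  rw [rateLD, attackRate]
  have hle : P / N ≤ 1 + (1 - α) ^ 2 * P / (N - α ^ 2 * P) := by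
    rw [add_div' _ _ _ hpos.ne', div_le_div_iff₀ hN hpos]
    nlinarith [sq_nonneg (N - α * P)]
  have := Real.logb_le_logb_of_le (b := 2) (by norm_num) (by positivity) hle
  linarith

/-- Where the power constraint is active, the largest admissible `α` is optimal. -/
theorem isLeast_rateMyop {P N σ : ℝ} (hP : 0 < P) (hN : 0 < N) (hσ : 0 < σ)
    (h₁ : P ^ 2 ≤ N * (P + σ ^ 2)) (h₂ : N ≤ P + σ ^ 2) :
    IsLeast (attackRate P N '' Set.Ioc 0 (Real.sqrt (N / (P + σ ^ 2)))) (rateMyop P N σ) := by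
  have hS : 0 < P + σ ^ 2 := by positivity
  set t : ℝ := Real.sqrt (N / (P + σ ^ 2)) with ht
  have ht0 : 0 < t := Real.sqrt_pos.2 (by positivity)
  have hmem : t ∈ Set.Ioc 0 (Real.sqrt (N / (P + σ ^ 2))) := ⟨ht0, le_rfl⟩
  have htS : t ^ 2 * (P + σ ^ 2) = N := by
    rw [ht, Real.sq_sqrt (by positivity), div_mul_cancel₀ _ hS.ne']
  have ht1 : t ≤ 1 := Real.sqrt_le_one.2 (by rwa [div_le_one hS])
  have htN : t * P ≤ N := by
    have : (t * P) ^ 2 ≤ N ^ 2 := by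
      have e : (t * P) ^ 2 * (P + σ ^ 2) = N * P ^ 2 := by
        rw [← htS]
        ring
      refine le_of_mul_le_mul_right ?_ hS
      rw [e]
      nlinarith
    exact le_of_sq_le_sq this hN.le
  have hpos := sub_sq_mul_pos hP hN hσ hmem
  have hd : N - t ^ 2 * P = t ^ 2 * σ ^ 2 := by
    rw [← htS]
    ring
  have hsqrt : Real.sqrt (N * (P + σ ^ 2)) = t * (P + σ ^ 2) := by
    rw [← htS, show t ^ 2 * (P + σ ^ 2) * (P + σ ^ 2) = (t * (P + σ ^ 2)) ^ 2 by ring,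
      Real.sqrt_sq (by positivity)]
  have hv : attackRate P N t = rateMyop P N σ := by
    rw [attackRate, rateMyop, hsqrt, hd]
    congr 2
    rw [← htS]
    field_simp
    ring
  refine ⟨⟨_, hmem, hv⟩, ?_⟩
  rintro _ ⟨α, hα, rfl⟩
  have hpα := sub_sq_mul_pos hP hN hσ hα
  rw [← hv]
  refine attackRate_le_attackRate hP hpos ?_
  have hαt : 0 ≤ t - α := by linarith [hα.2]
  have hα0 := hα.1
  have key : 0 ≤ (t - α) * (N * (2 - α - t) - P * (t + α - 2 * α * t)) := by
    refine mul_nonneg hαt ?_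
    have h1 : t * P * (2 - α - t) ≤ N * (2 - α - t) :=
      mul_le_mul_of_nonneg_right htN (by linarith)
    have h2 : 0 ≤ P * ((t - α) * (1 - t)) :=
      mul_nonneg hP.le (mul_nonneg hαt (by linarith))
    linarith
  rw [div_le_div_iff₀ hpos hpα]
  have e : (1 - α) ^ 2 * P * (N - t ^ 2 * P) - (1 - t) ^ 2 * P * (N - α ^ 2 * P) =
      P * ((t - α) * (N * (2 - α - t) - P * (t + α - 2 * α * t))) := by ring
  have := mul_nonneg hP.le key
  linarith

/-- With enough power, `α = 1` erases the transmitted signal. -/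
theorem isLeast_zero {P N σ : ℝ} (hP : 0 < P) (hN : 0 < N) (hσ : 0 < σ) (h : P + σ ^ 2 ≤ N) :
    IsLeast (attackRate P N '' Set.Ioc 0 (Real.sqrt (N / (P + σ ^ 2)))) 0 := by
  have hS : 0 < P + σ ^ 2 := by positivity
  have hmem : (1 : ℝ) ∈ Set.Ioc 0 (Real.sqrt (N / (P + σ ^ 2))) :=
    ⟨one_pos, Real.le_sqrt_of_sq_le (by rw [one_pow, one_le_div hS]; exact h)⟩
  refine ⟨⟨1, hmem, by simp [attackRate]⟩, ?_⟩
  rintro _ ⟨α, hα, rfl⟩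
  have hpos := sub_sq_mul_pos hP hN hσ hα
  have : 0 ≤ (1 - α) ^ 2 * P / (N - α ^ 2 * P) := by positivity
  have := Real.logb_nonneg (b := 2) (by norm_num)
    (by linarith : 1 ≤ 1 + (1 - α) ^ 2 * P / (N - α ^ 2 * P))
  rw [attackRate]
  linarith

lemma myopicCapacity_le_of_isLeast {P N σ r : ℝ} (hP : 0 < P) (hN : 0 < N) (hσ : 0 < σ)
    (h : IsLeast (attackRate P N '' Set.Ioc 0 (Real.sqrt (N / (P + σ ^ 2)))) r)
    (A B K : ℕ → RandomSource) : myopicCapacity P N σ A B K ≤ (r : EReal) := by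
  obtain ⟨α, hα, rfl⟩ := h.1
  exact myopicCapacity_le_attackRate hP hN hσ hα A B K

lemma myopicCapacity_eq_zero {P N σ : ℝ} (hP : 0 < P) (hN : 0 < N) (hσ : 0 < σ)
    (h : P + σ ^ 2 ≤ N) (A B K : ℕ → RandomSource) : myopicCapacity P N σ A B K = 0 :=
  le_antisymm (by simpa using
    myopicCapacity_le_of_isLeast hP hN hσ (isLeast_zero hP hN hσ h) A B K)
    (capacity_nonneg _ _ _ _ _)

/-- The capacity with unlimited common randomness vanishes only if James can erase the signal. -/
theorem unlimitedCapacity_eq_zero_iff {P N σ : ℝ} (hP : 0 < P) (hN : 0 < N) (hσ : 0 < σ)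
    (A B K : ℕ → RandomSource) : unlimitedCapacity P N σ A B = 0 ↔ P + σ ^ 2 ≤ N := by
  constructor
  · intro h0
    by_contra! h
    obtain ⟨K', R, hR, hach⟩ := exists_achievable hP hN hσ h A B
    have h1 : (R : EReal) ≤ myopicCapacity P N σ A B K' := le_sSup ⟨R, ⟨hR.le, hach⟩, rfl⟩
    have h2 : myopicCapacity P N σ A B K' ≤ unlimitedCapacity P N σ A B :=
      le_iSup (fun K => myopicCapacity P N σ A B K) K'
    rw [h0] at h2
    exact absurd (EReal.coe_le_coe_iff.1 (h1.trans h2)) (not_le.2 hR)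
  · intro h
    have : Nonempty (ℕ → RandomSource) := ⟨K⟩
    simp [unlimitedCapacity, myopicCapacity_eq_zero hP hN hσ h]

end Myopic

end

theorem mainTheorem6 (P N σ : ℝ) (hP : 0 < P) (hN : 0 < N) (hσ : 0 < σ)
    (A B K : ℕ → Myopic.RandomSource) :
    -- the scale-and-babble attack is an admissible jamming strategy
    (∀ α ε : ℝ, 0 ≤ α → α ≤ Real.sqrt (N / (P + σ ^ 2)) → 0 < ε → ε < 1 → ∀ n : ℕ,
      Myopic.scaleBabble n N α (Myopic.babbleVar P N σ α ε) ∈ Myopic.jammers n N) ∧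
    -- it turns the channel into an AWGN channel, up to an exponentially small error
    (∀ α ε : ℝ, 0 ≤ α → α < Real.sqrt (N / (P + σ ^ 2)) → 0 < ε → ε < 1 →
      ∃ c : ℝ, 0 < c ∧ ∀ᶠ n : ℕ in atTop, ∀ x : Myopic.Block n, ‖x‖ ≤ Real.sqrt (n * P) →
        Myopic.clipProb n N σ α (Myopic.babbleVar P N σ α ε) x ≤ (2 : ℝ) ^ (-(c * n)) ∧
        ∀ E : Set (Myopic.Block n), MeasurableSet E →
          |(Myopic.jammed σ (Myopic.scaleBabble n N α (Myopic.babbleVar P N σ α ε)) x).real E -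
            (Myopic.awgn n (α ^ 2 * σ ^ 2 + Myopic.babbleVar P N σ α ε) ((1 - α) • x)).real E| ≤
              (2 : ℝ) ^ (-(c * n))) ∧
    -- the capacity of the channel under this attack
    (∀ α ε : ℝ, 0 ≤ α → α ≤ Real.sqrt (N / (P + σ ^ 2)) → 0 < ε → ε < 1 →
      Myopic.capacity P A B K
          (fun n => {Myopic.jammed σ (Myopic.scaleBabble n N α (Myopic.babbleVar P N σ α ε))}) ≤
        ((1 / 2 * Real.logb 2 (1 + (1 - α) ^ 2 * P /
          (α ^ 2 * σ ^ 2 + Myopic.babbleVar P N σ α ε)) : ℝ) : EReal)) ∧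
    -- the capacity of the myopic channel
    (∃ r : ℝ, IsLeast (Myopic.attackRate P N '' Set.Ioc 0 (Real.sqrt (N / (P + σ ^ 2)))) r ∧
      Myopic.myopicCapacity P N σ A B K ≤ (r : EReal)) ∧
    -- the value of the bound in the three regions
    (σ ^ 2 / P ≤ 1 / (N / P) - 1 →
      IsLeast (Myopic.attackRate P N '' Set.Ioc 0 (Real.sqrt (N / (P + σ ^ 2))))
        (Myopic.rateLD P N) ∧
      Myopic.myopicCapacity P N σ A B K ≤ (Myopic.rateLD P N : EReal)) ∧
    (max (1 / (N / P) - 1) (N / P - 1) ≤ σ ^ 2 / P →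
      IsLeast (Myopic.attackRate P N '' Set.Ioc 0 (Real.sqrt (N / (P + σ ^ 2))))
        (Myopic.rateMyop P N σ) ∧
      Myopic.myopicCapacity P N σ A B K ≤ (Myopic.rateMyop P N σ : EReal)) ∧
    (σ ^ 2 / P ≤ N / P - 1 →
      IsLeast (Myopic.attackRate P N '' Set.Ioc 0 (Real.sqrt (N / (P + σ ^ 2)))) 0 ∧
      Myopic.myopicCapacity P N σ A B K = 0) ∧
    -- for `N > P` the capacity with unlimited common randomness is not always zero
    (P < N → (Myopic.unlimitedCapacity P N σ A B = 0 ↔ σ ^ 2 / P ≤ N / P - 1)) := by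
  have hz : σ ^ 2 / P ≤ N / P - 1 ↔ P + σ ^ 2 ≤ N := by
    rw [div_le_iff₀ hP, sub_mul, div_mul_cancel₀ _ hP.ne']
    constructor <;> intro h <;> linarith
  have hLD : σ ^ 2 / P ≤ 1 / (N / P) - 1 ↔ N * (P + σ ^ 2) ≤ P ^ 2 := by
    rw [one_div_div, div_le_iff₀ hP, sub_mul, ← sub_nonneg, ← sub_nonneg (a := P ^ 2)]
    have e : P / N * P - 1 * P - σ ^ 2 = (P ^ 2 - N * (P + σ ^ 2)) / N := by
      field_simp
      ring
    rw [e, le_div_iff₀ hN, zero_mul]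
  have hcap : ∀ {r}, IsLeast (Myopic.attackRate P N '' Set.Ioc 0 (Real.sqrt (N / (P + σ ^ 2)))) r →
      Myopic.myopicCapacity P N σ A B K ≤ (r : EReal) := fun h =>
    Myopic.myopicCapacity_le_of_isLeast hP hN hσ h A B K
  refine ⟨fun α ε _ _ _ _ n => Myopic.scaleBabble_mem_jammers n N α _, ?_, ?_, ?_, ?_, ?_, ?_, ?_⟩
  · intro α ε hα hα1 hε hε1
    obtain ⟨c, hc, hb⟩ := Myopic.scaleBabble_approx_awgn (N := N) (σ := σ) hP hα hα1 hε hε1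
    exact ⟨c, hc, Eventually.of_forall hb⟩
  · intro α ε hα hα1 hε hε1
    have hle := Myopic.sq_mul_le_of_le_sqrt hP hN hα hα1
    have hv := Myopic.babbleVar_nonneg hle hε1
    refine Myopic.capacity_scaleBabble_le hP.le hv ?_ ?_ A B K
    · rcases hα.eq_or_lt with rfl | h0
      · have : 0 < N * (1 - ε) := mul_pos hN (by linarith)
        simpa [Myopic.babbleVar] using this
      · have : 0 < α ^ 2 * σ ^ 2 := by positivity
        linarith
    · unfold Myopic.babbleVar
      nlinarith
  · by_cases h0 : P + σ ^ 2 ≤ N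
    · exact ⟨_, Myopic.isLeast_zero hP hN hσ h0, hcap (Myopic.isLeast_zero hP hN hσ h0)⟩
    by_cases h1 : N * (P + σ ^ 2) ≤ P ^ 2
    · exact ⟨_, Myopic.isLeast_rateLD hP hN hσ h1, hcap (Myopic.isLeast_rateLD hP hN hσ h1)⟩
    have h := Myopic.isLeast_rateMyop hP hN hσ (not_le.1 h1).le (not_le.1 h0).le
    exact ⟨_, h, hcap h⟩
  · intro h
    have h' := Myopic.isLeast_rateLD hP hN hσ (hLD.1 h)
    exact ⟨h', hcap h'⟩
  · intro h
    have h1 : P ^ 2 ≤ N * (P + σ ^ 2) := by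
      by_contra! hc
      have heq : σ ^ 2 / P = 1 / (N / P) - 1 :=
        le_antisymm (hLD.2 hc.le) ((le_max_left _ _).trans h)
      rw [one_div_div] at heq
      field_simp at heq
      linarith
    have h0 : N ≤ P + σ ^ 2 := by
      have := (le_max_right _ _).trans h
      rw [le_div_iff₀ hP, sub_mul, div_mul_cancel₀ _ hP.ne'] at this
      linarith
    have h' := Myopic.isLeast_rateMyop hP hN hσ h1 h0
    exact ⟨h', hcap h'⟩
  · intro h
    exact ⟨Myopic.isLeast_zero hP hN hσ (hz.1 h),
      Myopic.myopicCapacity_eq_zero hP hN hσ (hz.1 h) A B K⟩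
  · intro _
    rw [hz]
    exact Myopic.unlimitedCapacity_eq_zero_iff hP hN hσ A B K
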